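/- Let $(\overline M,\overline g)$ be an $(n+1)$-dimensional semi-Riemannian manifold with Levi-Civita connection $\overline\nabla$, and let $x:M\to\overline M$ be a smoothly embedded null hypersurface, i.e. $\dim M=n$ and $g=x^\star\overline g$ is degenerate at every point of $M$. Let $N$ be a null rigging for $M$: a smooth vector field on an open set containing $x(M)$ which along $M$ is nowhere tangent to $M$ and satisfies $\overline g(N,N)=0$. Put $\eta=x^\star(\overline g(N,\cdot))$ and assume that the normalization is closed, i.e. $d\eta=0$ on $M$. Let $S(TM)=\ker\eta$ be the screen distribution and let $\xi$ be the rigged vector field, the unique vector field tangent to $M$ with $\overline g(\xi,X)=0$ for all $X$ tangent to $M$ and $\overline g(\xi,N)=1$. Let $\nabla$ be the connection on $M$ induced from $\overline\nabla$ by projection on $TM$ along $N$. Define $\tau$, $A_N$ and $\overset{\star}{A}_\xi$ by $$\tau(X)=\overline g(\overline\nabla_XN,\xi),\qquad \overline\nabla_XN=-A_NX+\tau(X)N,\qquad \nabla_X\xi=-\overset{\star}{A}_\xi X-\tau(X)\xi$$ for $X$ tangent to $M$, and put $\overset{\star}{H}=\frac1n\operatorname{tr}\overset{\star}{A}_\xi$.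 Let $\alpha$ be a nowhere vanishing smooth function on $M$ that is constant on each leaf of $S(TM)$, and let $g_\alpha=g+\alpha\,\eta\otimes\eta$ be the $\alpha$-associated semi-Riemannian metric on $M$. Let $\overline{Ric}$ and $Ric_\alpha$ be the Ricci tensors of $\overline g$ and $g_\alpha$, with the conventions $R(X,Y)Z=\nabla_X\nabla_YZ-\nabla_Y\nabla_XZ-\nabla_{[X,Y]}Z$ and $Ric(X,Y)=\operatorname{tr}(Z\mapsto R(Z,X)Y)$, and let $d\tau(X,Y)=X\cdot\tau(Y)-Y\cdot\tau(X)-\tau([X,Y])$. Then, on $M$: 1. $\displaystyle Ric_\alpha(\xi,\xi)=\overline{Ric}(\xi,\xi)-n\Big[\tau(\xi)+\frac{1}{2\alpha}d\alpha(\xi)\Big]\overset{\star}{H}$; 2. for every section $\mathcal X$ of $S(TM)$, $\displaystyle Ric_\alpha(\xi,\mathcal X)=\overline{Ric}(\xi,\mathcal X)+d\tau(\xi,\mathcal X)+n\,g(A_N\xi,\mathcal X)\,\overset{\star}{H}$. -/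

import Mathlib

open scoped Manifold ContDiff

noncomputable section

namespace NullGeom

/-! Throughout, a manifold `M` is modelled on a finite-dimensional real normed space `E`
(model with corners `𝓘(ℝ, E)`, so without boundary). The chart `extChartAt 𝓘(ℝ, E) p` identifies
`T_p M` with `E` by the identity; tensors at `p` are computed in this chart. -/

section Local

variable {E : Type*} [NormedAddCommGroup E] [NormedSpace ℝ E]

set_option maxSynthPendingDepth 3 in
/-- For a metric `G` on an open subset of `E` with derivative `DG = fderiv ℝ G u` at `u`, the
Christoffel symbols of the first kind
`(v, w, z) ↦ (DG(v)(w, z) + DG(w)(v, z) - DG(z)(v, w)) / 2`. -/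
def christoffelFirst (G : E → E →L[ℝ] E →L[ℝ] ℝ) (u : E) : E →L[ℝ] E →L[ℝ] E →L[ℝ] ℝ :=
  (1 / 2 : ℝ) • (fderiv ℝ G u + (fderiv ℝ G u).flip
    - ((ContinuousLinearMap.flipₗᵢ ℝ E E ℝ).toContinuousLinearEquiv.toContinuousLinearMap.comp
        (fderiv ℝ G u).flip))

theorem christoffelFirst_apply (G : E → E →L[ℝ] E →L[ℝ] ℝ) (u v w z : E) :
    christoffelFirst G u v w z =
      (1 / 2) * (fderiv ℝ G u v w z + fderiv ℝ G u w v z - fderiv ℝ G u z v w) := rfl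

/-- The Christoffel symbols (of the second kind) of the metric `G` at `u`, as a bilinear map:
`Γ(v, w)` is the vector `y` with `G u y z = christoffelFirst G u v w z` for all `z`. -/
def christoffel (G : E → E →L[ℝ] E →L[ℝ] ℝ) (u : E) : E →L[ℝ] E →L[ℝ] E :=
  (ContinuousLinearMap.compL ℝ E (E →L[ℝ] ℝ) E (G u).inverse) ∘L christoffelFirst G u

/-- The curvature `R(X,Y)Z = ∇_X ∇_Y Z - ∇_Y ∇_X Z - ∇_[X,Y] Z` of the connection with
Christoffel symbols `Γ`, at `u`. -/
def curvatureOf (Γ : E → E →L[ℝ] E →L[ℝ] E) (u X Y Z : E) : E :=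
  fderiv ℝ Γ u X Y Z - fderiv ℝ Γ u Y X Z + Γ u X (Γ u Y Z) - Γ u Y (Γ u X Z)

/-- `Ric(Y, Z) = tr (X ↦ R(X, Y) Z)`. -/
def ricciOf (Γ : E → E →L[ℝ] E →L[ℝ] E) (u Y Z : E) : ℝ :=
  LinearMap.trace ℝ E
    { toFun := fun X => curvatureOf Γ u X Y Z
      map_add' := by
        intro a b
        simp only [curvatureOf, map_add, add_apply]
        abel
      map_smul' := by
        intro c a
        simp only [curvatureOf, map_smul, smul_apply, RingHom.id_apply, smul_add, smul_sub] }

/-- The pullback `B(A ·, A ·)` of a bilinear form by a linear map. -/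
def pullBilin {F : Type*} [NormedAddCommGroup F] [NormedSpace ℝ F]
    (B : F →L[ℝ] F →L[ℝ] ℝ) (A : E →L[ℝ] F) : E →L[ℝ] E →L[ℝ] ℝ :=
  B.bilinearComp A A

end Local

section Manifold

variable {E : Type*} [NormedAddCommGroup E] [NormedSpace ℝ E]
  {M : Type*} [TopologicalSpace M] [ChartedSpace E M] [IsManifold 𝓘(ℝ, E) ∞ M]

/-- Semi-Riemannian metric: a smooth field of symmetric non-degenerate bilinear forms on the
tangent spaces. (Its index is then locally constant.) -/
structure IsSemiRiemannianMetric
    (g : ∀ p : M, TangentSpace 𝓘(ℝ, E) p →L[ℝ] TangentSpace 𝓘(ℝ, E) p →L[ℝ] ℝ) : Prop where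
  symm : ∀ p v w, g p v w = g p w v
  nondegenerate : ∀ p v, (∀ w, g p v w = 0) → v = 0
  contMDiff : ContMDiff 𝓘(ℝ, E) (𝓘(ℝ, E).prod 𝓘(ℝ, E →L[ℝ] E →L[ℝ] ℝ)) ∞
    (fun p => Bundle.TotalSpace.mk' (E →L[ℝ] E →L[ℝ] ℝ)
      (E := fun p : M => TangentSpace 𝓘(ℝ, E) p →L[ℝ] TangentSpace 𝓘(ℝ, E) p →L[ℝ] ℝ) p (g p))

/-- Coordinate expression, in the chart at `p`, of a field `g` of bilinear forms: the pullback of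
`g` by the inverse of the chart. -/
def bilinInChart
    (g : ∀ q : M, TangentSpace 𝓘(ℝ, E) q →L[ℝ] TangentSpace 𝓘(ℝ, E) q →L[ℝ] ℝ) (p : M)
    (u : E) : E →L[ℝ] E →L[ℝ] ℝ :=
  pullBilin (E := E) (F := E) (g ((extChartAt 𝓘(ℝ, E) p).symm u))
    (mfderiv 𝓘(ℝ, E) 𝓘(ℝ, E) (extChartAt 𝓘(ℝ, E) p).symm u)

/-- Coordinate expression, in the chart at `p`, of a 1-form. -/
def formInChart (θ : ∀ q : M, TangentSpace 𝓘(ℝ, E) q →L[ℝ] ℝ) (p : M) (u : E) : E →L[ℝ] ℝ :=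
  ContinuousLinearMap.comp (M₂ := E) (θ ((extChartAt 𝓘(ℝ, E) p).symm u))
    (mfderiv 𝓘(ℝ, E) 𝓘(ℝ, E) (extChartAt 𝓘(ℝ, E) p).symm u)

/-- Exterior derivative of a 1-form, `dθ(X,Y) = X·θ(Y) - Y·θ(X) - θ([X,Y])`, computed with
constant coordinate fields. -/
def dForm (θ : ∀ q : M, TangentSpace 𝓘(ℝ, E) q →L[ℝ] ℝ) (p : M)
    (v w : TangentSpace 𝓘(ℝ, E) p) : ℝ :=
  fderiv ℝ (formInChart θ p) (extChartAt 𝓘(ℝ, E) p p) v w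
    - fderiv ℝ (formInChart θ p) (extChartAt 𝓘(ℝ, E) p p) w v

/-- The Ricci tensor at `p` of the Levi-Civita connection of the metric `g`. -/
def ricci (g : ∀ q : M, TangentSpace 𝓘(ℝ, E) q →L[ℝ] TangentSpace 𝓘(ℝ, E) q →L[ℝ] ℝ) (p : M)
    (v w : TangentSpace 𝓘(ℝ, E) p) : ℝ :=
  ricciOf (christoffel (bilinInChart g p)) (extChartAt 𝓘(ℝ, E) p p) v w

variable {E' : Type*} [NormedAddCommGroup E'] [NormedSpace ℝ E']
  {P : Type*} [TopologicalSpace P] [ChartedSpace E' P]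

/-- Covariant derivative, for the Levi-Civita connection `∇` of the metric `g` on `M`, of a vector
field `V` along a map `f : P → M`: in coordinates `(V^i)` of `V` in the chart of `M` at `f p`,
`∇_v V = dV(v) + Γ(df(v), V)`. -/
def covDerivAlong
    (g : ∀ q : M, TangentSpace 𝓘(ℝ, E) q →L[ℝ] TangentSpace 𝓘(ℝ, E) q →L[ℝ] ℝ)
    (f : P → M) (V : ∀ a : P, TangentSpace 𝓘(ℝ, E) (f a)) (p : P) :
    TangentSpace 𝓘(ℝ, E') p →L[ℝ] TangentSpace 𝓘(ℝ, E) (f p) :=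
  mvfderiv 𝓘(ℝ, E') (fun a : P =>
      (mfderiv 𝓘(ℝ, E) 𝓘(ℝ, E) (extChartAt 𝓘(ℝ, E) (f p)) (f a) (V a) : E)) p
    + ((christoffel (bilinInChart g (f p)) (extChartAt 𝓘(ℝ, E) (f p) (f p))).flip (V p) :
        E →L[ℝ] E).comp (mfderiv 𝓘(ℝ, E') 𝓘(ℝ, E) f p)

/-- Levi-Civita covariant derivative `v ↦ ∇_v V` of a vector field `V` on `M`. -/
def covDeriv
    (g : ∀ q : M, TangentSpace 𝓘(ℝ, E) q →L[ℝ] TangentSpace 𝓘(ℝ, E) q →L[ℝ] ℝ)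
    (V : ∀ q : M, TangentSpace 𝓘(ℝ, E) q) (p : M) :
    TangentSpace 𝓘(ℝ, E) p →L[ℝ] TangentSpace 𝓘(ℝ, E) p :=
  covDerivAlong (P := M) (E' := E) g id V p

/-- The leaf through `p` of the distribution `ker η` (when it is integrable): all points that can
be joined to `p` by concatenating smooth curves tangent to `ker η`. -/
def leaf (η : ∀ q : M, TangentSpace 𝓘(ℝ, E) q →L[ℝ] ℝ) (p : M) : Set M :=
  {q | Relation.EqvGen (fun a b : M => ∃ γ : ℝ → M, ContMDiff 𝓘(ℝ, ℝ) 𝓘(ℝ, E) ∞ γ ∧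
    (∀ t : ℝ, η (γ t) (mfderiv 𝓘(ℝ, ℝ) 𝓘(ℝ, E) γ t (1 : ℝ)) = 0) ∧ γ 0 = a ∧ γ 1 = b) p q}

end Manifold

section Hypersurface

/-! `x : M → M'` is a hypersurface (`M` modelled on `E`, `M'` on `F`), `g` a metric on `M'`, and
`N` a rigging, given as a vector field on `M'` of which only the values near `x(M)` matter. -/

variable {E : Type*} [NormedAddCommGroup E] [NormedSpace ℝ E]
  {F : Type*} [NormedAddCommGroup F] [NormedSpace ℝ F]
  {M : Type*} [TopologicalSpace M] [ChartedSpace E M] [IsManifold 𝓘(ℝ, E) ∞ M]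
  {M' : Type*} [TopologicalSpace M'] [ChartedSpace F M'] [IsManifold 𝓘(ℝ, F) ∞ M']

/-- The differential of `x` at `p`. -/
def dMap (x : M → M') (p : M) : TangentSpace 𝓘(ℝ, E) p →L[ℝ] TangentSpace 𝓘(ℝ, F) (x p) :=
  mfderiv 𝓘(ℝ, E) 𝓘(ℝ, F) x p

variable (g : ∀ y : M', TangentSpace 𝓘(ℝ, F) y →L[ℝ] TangentSpace 𝓘(ℝ, F) y →L[ℝ] ℝ)
  (x : M → M') (N : ∀ y : M', TangentSpace 𝓘(ℝ, F) y)

/-- The (degenerate) first fundamental form, the pullback of `g` by `x`. -/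
def pullbackMetric (p : M) :
    TangentSpace 𝓘(ℝ, E) p →L[ℝ] TangentSpace 𝓘(ℝ, E) p →L[ℝ] ℝ :=
  pullBilin (E := E) (F := F) (g (x p)) (dMap x p)

/-- `x` is a null hypersurface: a smoothly embedded submanifold of codimension one, the pullback
of `g` to which is degenerate at every point. -/
structure IsNullHypersurface : Prop where
  embedding : Manifold.IsSmoothEmbedding 𝓘(ℝ, E) 𝓘(ℝ, F) ∞ x
  codim : Module.finrank ℝ F = Module.finrank ℝ E + 1
  null : ∀ p : M, ∃ u : TangentSpace 𝓘(ℝ, E) p, u ≠ 0 ∧ ∀ v, pullbackMetric g x p u v = 0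

/-- `N` is a null rigging for `x`: a smooth vector field on an open set `U ⊇ x(M)`, which along `M`
is transverse to `M` and null. -/
structure IsNullRigging (U : Set M') : Prop where
  isOpen : IsOpen U
  subset : Set.range x ⊆ U
  contMDiffOn : ContMDiffOn 𝓘(ℝ, F) 𝓘(ℝ, F).tangent ∞
    (fun y => (⟨y, N y⟩ : TangentBundle 𝓘(ℝ, F) M')) U
  transverse : ∀ p : M, ∀ v : TangentSpace 𝓘(ℝ, E) p, dMap x p v ≠ N (x p)
  null : ∀ p : M, g (x p) (N (x p)) (N (x p)) = 0

/-- `η`, the pullback by `x` of the 1-form `g(N, ·)`. Its kernel is the screen distribution. -/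
def eta (p : M) : TangentSpace 𝓘(ℝ, E) p →L[ℝ] ℝ :=
  (g (x p) (N (x p))).comp (dMap x p)

/-- The rigged vector field: the unique `ξ` tangent to `M` with `ξ ⟂ TM` and `g(ξ, N) = 1`. -/
def riggedField (p : M) : TangentSpace 𝓘(ℝ, E) p :=
  Classical.epsilon fun u : TangentSpace 𝓘(ℝ, E) p =>
    (∀ v, pullbackMetric g x p u v = 0) ∧ g (x p) (dMap x p u) (N (x p)) = 1

/-- The decomposition `T M'|_M = TM ⊕ span N`: the inverse of the isomorphism
`(v, b) ↦ dx(v) + b N`. Its components are the tangential and the transverse part. -/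
def splitting (p : M) : TangentSpace 𝓘(ℝ, F) (x p) →L[ℝ] TangentSpace 𝓘(ℝ, E) p × ℝ :=
  ((dMap x p).coprod ((ContinuousLinearMap.id ℝ ℝ).smulRight (N (x p)))).inverse

/-- The projection of `T M'|_M` onto `TM` along `N`. -/
def tangentialPart (p : M) : TangentSpace 𝓘(ℝ, F) (x p) →L[ℝ] TangentSpace 𝓘(ℝ, E) p :=
  (ContinuousLinearMap.fst ℝ (TangentSpace 𝓘(ℝ, E) p) ℝ).comp (splitting x N p)

/-- The connection induced on `M`: `∇_v Y` is the tangential part of the Levi-Civita derivative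
of `Y` along `x`. -/
def inducedConnection (Y : ∀ p : M, TangentSpace 𝓘(ℝ, E) p) (p : M) :
    TangentSpace 𝓘(ℝ, E) p →L[ℝ] TangentSpace 𝓘(ℝ, E) p :=
  (tangentialPart x N p).comp (covDerivAlong g x (fun q => dMap x q (Y q)) p)

/-- The Levi-Civita derivative `v ↦ ∇_v N` of the rigging in directions tangent to `M`. -/
def derivRigging (p : M) : TangentSpace 𝓘(ℝ, E) p →L[ℝ] TangentSpace 𝓘(ℝ, F) (x p) :=
  (covDeriv g N (x p)).comp (dMap x p)

/-- The rotation 1-form `τ(v) = g(∇_v N, ξ) = g(ξ, ∇_v N)`. -/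
def rotationForm (p : M) : TangentSpace 𝓘(ℝ, E) p →L[ℝ] ℝ :=
  ContinuousLinearMap.comp (g (x p) (dMap (E := E) x p (riggedField g x N p)))
    (derivRigging g x N p)

/-- The shape operator `A_N`: minus the tangential part of `∇_v N`. -/
def shapeN (p : M) : TangentSpace 𝓘(ℝ, E) p →L[ℝ] TangentSpace 𝓘(ℝ, E) p :=
  -((tangentialPart x N p).comp (derivRigging g x N p))

/-- The screen shape operator `A*_ξ`, given by `∇_v ξ = - A*_ξ v - τ(v) ξ` for the induced
connection. -/
def screenShape (p : M) : TangentSpace 𝓘(ℝ, E) p →L[ℝ] TangentSpace 𝓘(ℝ, E) p :=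
  -(inducedConnection g x N (riggedField g x N) p)
    - (rotationForm g x N p).smulRight (riggedField g x N p)

/-- The mean curvature `H* = (1/n) tr A*_ξ` of the null hypersurface, `n = dim M`. -/
def meanCurvature (p : M) : ℝ :=
  (1 / (Module.finrank ℝ E : ℝ)) *
    LinearMap.trace ℝ (TangentSpace 𝓘(ℝ, E) p) (screenShape g x N p).toLinearMap

/-- The `α`-associated metric `g_α = x^* g + α η ⊗ η`. -/
def associatedMetric (α : M → ℝ) (p : M) :
    TangentSpace 𝓘(ℝ, E) p →L[ℝ] TangentSpace 𝓘(ℝ, E) p →L[ℝ] ℝ :=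
  pullbackMetric g x p + α p • (eta g x N p).smulRight (eta g x N p)

end Hypersurface

end NullGeom

end

/-! Read in charts, the theorem concerns a map `X` between vector spaces, a metric `G` and its
Christoffel symbols. Let B be the ξ-component of the Hessian ∇dX and C(v,w) = g(∇_v N, w). Splitting
along TM ⊕ ℝN gives the Gauss and Weingarten formulas for the induced connection ∇, with B(ξ,·) = 0
because ξ is null and orthogonal to TM.

The central point is `christoffel_localAssociated`: the Levi-Civita connection of g_α is ∇ + S ⊗ ξ
with S = B/α + C + (dα(ξ)/2α) η ⊗ η. Indeed (∇_v η)(w) = C(v,w), so dη = 0 makes C, hence S,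
symmetric. Constancy of α on the leaves gives dα = dα(ξ) η, which makes the connection metric.

Adding S ⊗ ξ changes Ric(ξ,z) by S(ξ,z) tr ∇ξ − S(∇_ξ ξ, z) (`ricciOf_add_smul`): the derivatives of
S occur only in a multiple of ξ whose trace vanishes. Since ∇_ξ ξ = −τ(ξ)ξ and tr ∇ξ = −tr A*_ξ −
τ(ξ), the change is −S(ξ,z) tr A*_ξ, where S(ξ,z) = −g(A_N ξ, z) + (τ(ξ) + dα(ξ)/2α) η(z). For ∇
itself, the Gauss and Ricci equations with the pair symmetry of the ambient curvature show that
Ric(ξ,z) exceeds the ambient value by dτ(ξ,z) (`ricciOf_localConnection`). The choices z = ξ and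
η(z) = 0 give the two formulas.

What remains is transport between M and charts, in particular chart independence of the covariant
derivative (`chartDeriv_covDeriv`) and of closedness (`fderiv_formInChart_symm`), and the passage
from leaves to dα (`mfderiv_eq_zero_of_constant_on_leaves`): locally η = df, and curves in level
sets of f stay in leaves. -/

open Filter Topology

noncomputable section

namespace NullGeom

/-! ### Levi-Civita connection and curvature symmetries on an open set of a vector space. -/

section LocalTheory

set_option maxSynthPendingDepth 3

variable {E : Type*} [NormedAddCommGroup E] [NormedSpace ℝ E] [FiniteDimensional ℝ E]
  {F : Type*} [NormedAddCommGroup F] [NormedSpace ℝ F] [FiniteDimensional ℝ F]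

omit [FiniteDimensional ℝ F] in
theorem isInvertible_of_injective (A : E →L[ℝ] F)
    (hA : Function.Injective A) (h : Module.finrank ℝ E = Module.finrank ℝ F)
    [FiniteDimensional ℝ F] : A.IsInvertible :=
  ⟨(LinearEquiv.ofInjectiveOfFinrankEq A.toLinearMap hA h).toContinuousLinearEquiv, by
    ext v; rfl⟩

/-- In finite dimension the dual has the same dimension, so injectivity of v ↦ B(v, ·) suffices. -/
theorem isInvertible_of_nondegenerate (B : E →L[ℝ] E →L[ℝ] ℝ)
    (hB : ∀ v, (∀ w, B v w = 0) → v = 0) : B.IsInvertible := by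
  refine isInvertible_of_injective B ?_ ?_
  · rw [injective_iff_map_eq_zero]
    intro v hv
    exact hB v fun w => by simp [hv]
  · rw [← (LinearMap.toContinuousLinearMap (𝕜 := ℝ) (E := E) (F' := ℝ)).finrank_eq]
    exact Subspace.dual_finrank_eq.symm

omit [FiniteDimensional ℝ E] in
theorem metric_christoffel {G : E → E →L[ℝ] E →L[ℝ] ℝ} {u : E} (hG : (G u).IsInvertible)
    (v w z : E) : G u (christoffel G u v w) z = christoffelFirst G u v w z := by
  have := hG.self_apply_inverse (christoffelFirst G u v w)
  exact congrArg (fun f => f z) this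

omit [FiniteDimensional ℝ E] [FiniteDimensional ℝ F] in
theorem fderiv_apply_apply {K : Type*} [NormedAddCommGroup K] [NormedSpace ℝ K]
    {G : E → F →L[ℝ] F →L[ℝ] K} {u : E} (hd : DifferentiableAt ℝ G u)
    (v : E) (w z : F) : fderiv ℝ (fun y => G y w z) u v = fderiv ℝ G u v w z := by
  have := ((hd.hasFDerivAt.clm_apply (hasFDerivAt_const w u)).clm_apply
    (hasFDerivAt_const z u)).fderiv
  rw [this]
  simp

omit [FiniteDimensional ℝ E] [FiniteDimensional ℝ F] in
-- The pullback is two compositions with `A`, one per slot, interleaved with `flip`; each of these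
-- operations is smooth.
theorem ContDiffAt.pullBilin {B : E → F →L[ℝ] F →L[ℝ] ℝ} {H : Type*} [NormedAddCommGroup H]
    [NormedSpace ℝ H] {A : E → H →L[ℝ] F} {u : E} {k : WithTop ℕ∞}
    (hB : ContDiffAt ℝ k B u) (hA : ContDiffAt ℝ k A u) :
    ContDiffAt ℝ k (fun y => pullBilin (B y) (A y)) u := by
  have h1 : ContDiffAt ℝ k (fun y => ((B y).comp (A y)).flip) u :=
    (ContinuousLinearMap.flipₗᵢ ℝ H F ℝ).contDiff.contDiffAt.comp u (hB.clm_comp hA)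
  exact (ContinuousLinearMap.flipₗᵢ ℝ H H ℝ).contDiff.contDiffAt.comp u (h1.clm_comp hA)

omit [FiniteDimensional ℝ E] in
theorem fderiv_apply_symm {K : Type*} [NormedAddCommGroup K] [NormedSpace ℝ K]
    {G : E → E →L[ℝ] E →L[ℝ] K} {u : E} (hd : DifferentiableAt ℝ G u) (hs : ∀ᶠ y in 𝓝 u, ∀ v w, G y v w = G y w v) (v w z : E) :
    fderiv ℝ G u v w z = fderiv ℝ G u v z w := by
  have h : (fun y => G y w z) =ᶠ[𝓝 u] fun y => G y z w := by
    filter_upwards [hs] with y hy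
    exact hy w z
  rw [← fderiv_apply_apply hd, ← fderiv_apply_apply hd, h.fderiv_eq]

omit [FiniteDimensional ℝ E] in
theorem christoffel_symm {G : E → E →L[ℝ] E →L[ℝ] ℝ} {u : E}
    (hd : DifferentiableAt ℝ G u) (hs : ∀ᶠ y in 𝓝 u, ∀ v w, G y v w = G y w v) (v w : E) :
    christoffel G u v w = christoffel G u w v := by
  refine congrArg (G u).inverse ?_
  ext z
  change christoffelFirst G u v w z = christoffelFirst G u w v z
  rw [christoffelFirst_apply, christoffelFirst_apply, fderiv_apply_symm hd hs z v w]
  ring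

omit [FiniteDimensional ℝ E] in
/-- The Levi-Civita connection is compatible with the metric. -/
theorem fderiv_metric_eq {G : E → E →L[ℝ] E →L[ℝ] ℝ} {u : E} (hG : (G u).IsInvertible)
    (hd : DifferentiableAt ℝ G u) (hs : ∀ᶠ y in 𝓝 u, ∀ v w, G y v w = G y w v) (v w z : E) :
    fderiv ℝ G u v w z = G u (christoffel G u v w) z + G u w (christoffel G u v z) := by
  rw [hs.self_of_nhds w, metric_christoffel hG, metric_christoffel hG, christoffelFirst_apply,
    christoffelFirst_apply, fderiv_apply_symm hd hs v z w, fderiv_apply_symm hd hs w v z,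
    fderiv_apply_symm hd hs z v w]
  ring

omit [FiniteDimensional ℝ E] in
/-- Uniqueness of the Levi-Civita connection. -/
theorem christoffel_eq_of_symm_of_metric {G : E → E →L[ℝ] E →L[ℝ] ℝ} {u : E}
    (hG : (G u).IsInvertible) (hs : ∀ v w, G u v w = G u w v) (B : E → E → E)
    (hB : ∀ v w, B v w = B w v)
    (hm : ∀ v w z, fderiv ℝ G u v w z = G u (B v w) z + G u w (B v z)) (v w : E) :
    christoffel G u v w = B v w := by
  apply hG.injective
  ext z
  rw [metric_christoffel hG, christoffelFirst_apply, hm, hm, hm, hs w, hs v, hs v, hB w v, hB z v,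
    hB z w]
  ring

theorem contDiffAt_christoffel {G : E → E →L[ℝ] E →L[ℝ] ℝ} {u : E} (hG : (G u).IsInvertible)
    (hd : ContDiffAt ℝ ∞ G u) : ContDiffAt ℝ ∞ (christoffel G) u := by
  have h1 : ContDiffAt ℝ ∞ (fun y => (G y).inverse) u := by
    have : CompleteSpace E := FiniteDimensional.complete ℝ E
    exact hG.contDiffAt_map_inverse.comp u hd
  have h2 : ContDiffAt ℝ ∞ (fderiv ℝ G) u := hd.fderiv_right (by norm_cast)
  have h3 : ContDiffAt ℝ ∞ (fun y => (fderiv ℝ G y).flip) u :=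
    (ContinuousLinearMap.flipₗᵢ ℝ E E (E →L[ℝ] ℝ)).contDiff.contDiffAt.comp
      u h2
  have h4 : ContDiffAt ℝ ∞ (christoffelFirst G) u :=
    ((h2.add h3).sub (contDiffAt_const.clm_comp h3)).const_smul (1 / 2 : ℝ)
  exact ((ContinuousLinearMap.compL ℝ E (E →L[ℝ] ℝ) E).contDiff.contDiffAt.comp u h1).clm_comp h4

omit [FiniteDimensional ℝ F] in
/-- Transformation law of the Christoffel symbols under a change of coordinates. -/
theorem christoffel_pullback {G : F → F →L[ℝ] F →L[ℝ] ℝ} {φ : E → F} {u : E}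
    (hG : (G (φ u)).IsInvertible) (hd : ContDiffAt ℝ ∞ G (φ u))
    (hs : ∀ᶠ y in 𝓝 (φ u), ∀ v w, G y v w = G y w v) (hφ : ContDiffAt ℝ ∞ φ u)
    (hinv : (fderiv ℝ φ u).IsInvertible) (v w : E) :
    fderiv ℝ φ u (christoffel (fun y => pullBilin (G (φ y)) (fderiv ℝ φ y)) u v w) =
      christoffel G (φ u) (fderiv ℝ φ u v) (fderiv ℝ φ u w) + fderiv ℝ (fderiv ℝ φ) u v w := by
  obtain ⟨e, he⟩ := hinv
  have hG' : (pullBilin (G (φ u)) (fderiv ℝ φ u)).IsInvertible := by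
    apply isInvertible_of_nondegenerate
    intro a ha
    have : G (φ u) (e a) = 0 := by
      ext b
      have := ha (e.symm b)
      simpa [pullBilin, ← he] using this
    have h2 : e a = 0 := hG.injective (by rw [this, map_zero])
    simpa using h2
  have hφ2 : ContDiffAt ℝ ∞ (fderiv ℝ φ) u := hφ.fderiv_right (by norm_cast)
  have hsymm : ∀ a b, fderiv ℝ (fderiv ℝ φ) u a b = fderiv ℝ (fderiv ℝ φ) u b a := fun a b =>
    (hφ.isSymmSndFDerivAt (by simp; norm_cast)) a b
  have hd1 : HasFDerivAt (fun y => G (φ y)) ((fderiv ℝ G (φ u)).comp (fderiv ℝ φ u)) u :=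
    (hd.differentiableAt (by simp)).hasFDerivAt.comp u (hφ.differentiableAt (by simp)).hasFDerivAt
  have hd2 := (hφ2.differentiableAt (by simp)).hasFDerivAt
  have hdiff : DifferentiableAt ℝ (fun y => pullBilin (G (φ y)) (fderiv ℝ φ y)) u :=
    (ContDiffAt.pullBilin ((hd.comp u hφ).of_le (by simp)) (hφ2.of_le (by simp))).differentiableAt
      one_ne_zero
  have key : ∀ a b c, fderiv ℝ (fun y => pullBilin (G (φ y)) (fderiv ℝ φ y)) u a b c =
      fderiv ℝ G (φ u) (fderiv ℝ φ u a) (fderiv ℝ φ u b) (fderiv ℝ φ u c)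
      + G (φ u) (fderiv ℝ (fderiv ℝ φ) u a b) (fderiv ℝ φ u c)
      + G (φ u) (fderiv ℝ φ u b) (fderiv ℝ (fderiv ℝ φ) u a c) := by
    intro a b c
    have e1 : HasFDerivAt (fun y => pullBilin (G (φ y)) (fderiv ℝ φ y) b c) _ u :=
      (hd1.clm_apply (hd2.clm_apply (hasFDerivAt_const b u))).clm_apply
        (hd2.clm_apply (hasFDerivAt_const c u))
    have e2 := (hdiff.hasFDerivAt.clm_apply (hasFDerivAt_const b u)).clm_apply
        (hasFDerivAt_const c u)
    have := congrArg (fun f => f a) (e2.unique e1)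
    simp at this
    rw [this]
    abel
  -- By uniqueness it is enough that the transformed symbols are symmetric and compatible with the
  -- pulled-back metric.
  rw [christoffel_eq_of_symm_of_metric (B := fun a b => e.symm
      (christoffel G (φ u) (fderiv ℝ φ u a) (fderiv ℝ φ u b) + fderiv ℝ (fderiv ℝ φ) u a b)) hG']
  · rw [← he]; simp
  · intro a b; exact hs.self_of_nhds _ _
  · intro a b
    simp only [hsymm a b, christoffel_symm (hd.differentiableAt (by simp)) hs (fderiv ℝ φ u a)]
  · intro a b c
    rw [key, fderiv_metric_eq hG (hd.differentiableAt (by simp)) hs]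
    simp [pullBilin, ← he]
    ring

/-- Differentiate metric compatibility once more, which requires it on a neighbourhood. The second
derivative of `G` is symmetric in a and b, and subtracting the two orders leaves the skewness of R.
-/
theorem curvatureOf_antisymm {G : E → E →L[ℝ] E →L[ℝ] ℝ} {u : E} (hG : (G u).IsInvertible)
    (hd : ContDiffAt ℝ ∞ G u) (hs : ∀ᶠ y in 𝓝 u, ∀ v w, G y v w = G y w v) (a b c d : E) :
    G u (curvatureOf (christoffel G) u a b c) d + G u c (curvatureOf (christoffel G) u a b d)
      = 0 := by
  have hev : ∀ᶠ y in 𝓝 u, ∀ v w z, fderiv ℝ G y v w z =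
      G y (christoffel G y v w) z + G y w (christoffel G y v z) := by
    have h1 : ∀ᶠ y in 𝓝 u, ContDiffAt ℝ 1 G y := (hd.of_le (by simp)).eventually (by simp)
    have h2 : ∀ᶠ y in 𝓝 u, (G y).IsInvertible := by
      obtain ⟨e, he⟩ := hG
      have := e.nhds
      rw [he] at this
      filter_upwards [hd.continuousAt this] with y hy
      exact hy
    filter_upwards [h1, h2, hs.eventually_nhds] with y hy1 hy2 hy3
    exact fderiv_metric_eq hy2 (hy1.differentiableAt one_ne_zero) hy3
  have hG1 := (hd.differentiableAt (by simp)).hasFDerivAt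
  have hG2 : DifferentiableAt ℝ (fderiv ℝ G) u :=
    (hd.fderiv_right (m := ∞) (by norm_cast)).differentiableAt (by simp)
  have hC := ((contDiffAt_christoffel hG hd).differentiableAt (by simp)).hasFDerivAt
  have hsymm : fderiv ℝ (fderiv ℝ G) u a b = fderiv ℝ (fderiv ℝ G) u b a :=
    (hd.isSymmSndFDerivAt (by simp; norm_cast)) a b
  have key : ∀ v w, fderiv ℝ (fderiv ℝ G) u v w c d =
      fderiv ℝ G u v (christoffel G u w c) d + G u (fderiv ℝ (christoffel G) u v w c) d
      + fderiv ℝ G u v c (christoffel G u w d) + G u c (fderiv ℝ (christoffel G) u v w d) := by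
    intro v w
    have e1 := ((hG2.hasFDerivAt.clm_apply (hasFDerivAt_const w u)).clm_apply
      (hasFDerivAt_const c u)).clm_apply (hasFDerivAt_const d u)
    have e2 : HasFDerivAt (fun y => G y (christoffel G y w c) d + G y c (christoffel G y w d))
        _ u :=
      ((hG1.clm_apply ((hC.clm_apply (hasFDerivAt_const w u)).clm_apply
        (hasFDerivAt_const c u))).clm_apply (hasFDerivAt_const d u)).add
      ((hG1.clm_apply (hasFDerivAt_const c u)).clm_apply
        ((hC.clm_apply (hasFDerivAt_const w u)).clm_apply (hasFDerivAt_const d u)))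
    have e3 := e2.congr_of_eventuallyEq (hev.mono fun y hy => hy w c d)
    have := congrArg (fun f => f v) (e1.unique e3)
    simp at this
    rw [this]
    abel
  have k1 := key a b
  have k2 := key b a
  rw [hsymm] at k1
  have hm := fderiv_metric_eq hG (hd.differentiableAt (by simp)) hs
  simp only [hm] at k1 k2
  simp only [curvatureOf, map_add, map_sub, add_apply, sub_apply]
  linarith

omit [FiniteDimensional ℝ E] in
/-- The first Bianchi identity for a torsion-free connection. -/
theorem curvatureOf_bianchi {Γ : E → E →L[ℝ] E →L[ℝ] E} {u : E} (hd : DifferentiableAt ℝ Γ u)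
    (hs : ∀ᶠ y in 𝓝 u, ∀ v w, Γ y v w = Γ y w v) (a b c : E) :
    curvatureOf Γ u a b c + curvatureOf Γ u b c a + curvatureOf Γ u c a b = 0 := by
  simp only [curvatureOf]
  rw [fderiv_apply_symm hd hs a c b, fderiv_apply_symm hd hs b c a, fderiv_apply_symm hd hs c b a,
    hs.self_of_nhds c b, hs.self_of_nhds c a, hs.self_of_nhds b a]
  abel

omit [FiniteDimensional ℝ E] in
theorem curvatureOf_swap (Γ : E → E →L[ℝ] E →L[ℝ] E) (u a b c : E) :
    curvatureOf Γ u b a c = - curvatureOf Γ u a b c := by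
  simp only [curvatureOf]
  abel

/-- A consequence of Bianchi and the two skew symmetries. It later moves the rigging N from a
direction slot of R to the slot on which R acts. -/
theorem curvatureOf_pair_symm {G : E → E →L[ℝ] E →L[ℝ] ℝ} {u : E} (hG : (G u).IsInvertible)
    (hd : ContDiffAt ℝ ∞ G u) (hs : ∀ᶠ y in 𝓝 u, ∀ v w, G y v w = G y w v) (a b c d : E) :
    G u (curvatureOf (christoffel G) u a b c) d = G u (curvatureOf (christoffel G) u c d a) b := by
  have hs' : ∀ᶠ y in 𝓝 u, ∀ v w, christoffel G y v w = christoffel G y w v := by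
    have h1 : ∀ᶠ y in 𝓝 u, ContDiffAt ℝ 1 G y := (hd.of_le (by simp)).eventually (by simp)
    filter_upwards [h1, hs.eventually_nhds] with y hy1 hy3
    exact christoffel_symm (hy1.differentiableAt one_ne_zero) hy3
  have B : ∀ p q r s, G u (curvatureOf (christoffel G) u p q r) s
      + G u (curvatureOf (christoffel G) u q r p) s
      + G u (curvatureOf (christoffel G) u r p q) s = 0 := by
    intro p q r s
    have h := curvatureOf_bianchi ((contDiffAt_christoffel hG hd).differentiableAt (by simp)) hs'
      p q r
    rw [← add_apply, ← add_apply, ← map_add, ← map_add, h, map_zero, zero_apply]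
  have S : ∀ p q r s, G u (curvatureOf (christoffel G) u q p r) s =
      -G u (curvatureOf (christoffel G) u p q r) s := by
    intro p q r s
    rw [curvatureOf_swap, map_neg, neg_apply]
  have A : ∀ p q r s, G u (curvatureOf (christoffel G) u p q s) r =
      -G u (curvatureOf (christoffel G) u p q r) s := by
    intro p q r s
    have h := curvatureOf_antisymm hG hd hs p q r s
    rw [hs.self_of_nhds r] at h
    linarith
  -- Octahedron argument: the Bianchi identities for the four cyclic shifts of (a,b,c,d), with all
  -- terms compared by skewness in the first pair (`S`) and in the last pair (`A`).
  linarith [B a b c d, B b c d a, B c d a b, B d a b c, S a b c d, S a c b d, S a d b c, S b c a d,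
    S b d a c, S c d a b, A a b c d, A a c b d, A a d b c, A b c a d, A b d a c, A c d a b,
    S a b d c, S a c d b, S a d c b, S b c d a, S b d c a, S c d b a]

end LocalTheory

/-! ### Curvature along a map, and the Gauss and Ricci equations. -/

section Curvature

set_option maxSynthPendingDepth 3

variable {E : Type*} [NormedAddCommGroup E] [NormedSpace ℝ E]
  {F : Type*} [NormedAddCommGroup F] [NormedSpace ℝ F]

/-- The curvature of the linear connection `d + θ` on the trivial bundle over `E` with fibre `F`. -/
def bundleCurvature (θ : E → E →L[ℝ] F →L[ℝ] F) (u v w : E) (y : F) : F :=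
  fderiv ℝ θ u v w y - fderiv ℝ θ u w v y + θ u v (θ u w y) - θ u w (θ u v y)

/-- The Ricci identity: `∇_v ∇_w s - ∇_w ∇_v s = K(v, w) s` for constant `v`, `w`. -/
theorem ricci_identity {θ : E → E →L[ℝ] F →L[ℝ] F} {s : E → F} {σ : E → E →L[ℝ] F} {u : E}
    (hθ : DifferentiableAt ℝ θ u) (hs : ContDiffAt ℝ ∞ s u)
    (hσ : ∀ᶠ y in 𝓝 u, ∀ w, σ y w = fderiv ℝ s y w + θ y w (s y))
    (v w : E) :
    (fderiv ℝ σ u v w + θ u v (σ u w)) - (fderiv ℝ σ u w v + θ u w (σ u v)) =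
      bundleCurvature θ u v w (s u) := by
  have hs2 : HasFDerivAt (fderiv ℝ s) (fderiv ℝ (fderiv ℝ s) u) u :=
    ((hs.fderiv_right (m := ∞) (by norm_cast)).differentiableAt (by simp)).hasFDerivAt
  have hs1 := (hs.differentiableAt (by simp)).hasFDerivAt
  have hsymm : fderiv ℝ (fderiv ℝ s) u v w = fderiv ℝ (fderiv ℝ s) u w v :=
    (hs.isSymmSndFDerivAt (by simp; norm_cast)) v w
  have e : HasFDerivAt (fun y => fderiv ℝ s y + (θ y).flip (s y)) _ u := hs2.add
    (((ContinuousLinearMap.flipₗᵢ ℝ E F F).toContinuousLinearEquiv.hasFDerivAt.comp u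
      hθ.hasFDerivAt).clm_apply hs1)
  have hσ' : σ =ᶠ[𝓝 u] fun y => fderiv ℝ s y + (θ y).flip (s y) := by
    filter_upwards [hσ] with y hy
    ext w
    exact hy w
  -- Only the symmetric second derivative and the mixed terms in `s` appear besides curvature, and
  -- these cancel on antisymmetrizing.
  have key : ∀ a b, fderiv ℝ σ u a b = fderiv ℝ (fderiv ℝ s) u a b + θ u b (fderiv ℝ s u a)
      + fderiv ℝ θ u a b (s u) := by
    intro a b
    rw [(e.congr_of_eventuallyEq hσ').fderiv]
    simp [add_assoc]
  rw [key, key, hsymm, hσ.self_of_nhds, hσ.self_of_nhds]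
  simp only [bundleCurvature, map_add]
  abel

/-- The curvature of the connection pulled back by a map `X`. -/
theorem bundleCurvature_pullback {Γ : F → F →L[ℝ] F →L[ℝ] F} {X : E → F} {u : E}
    (hΓ : DifferentiableAt ℝ Γ (X u)) (hX : ContDiffAt ℝ ∞ X u) (v w : E) (y : F) :
    bundleCurvature (fun a => (Γ (X a)).comp (fderiv ℝ X a)) u v w y =
      curvatureOf Γ (X u) (fderiv ℝ X u v) (fderiv ℝ X u w) y := by
  have hX2 : HasFDerivAt (fderiv ℝ X) (fderiv ℝ (fderiv ℝ X) u) u :=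
    ((hX.fderiv_right (m := ∞) (by norm_cast)).differentiableAt (by simp)).hasFDerivAt
  have hX1 := (hX.differentiableAt (by simp)).hasFDerivAt
  have hsymm : fderiv ℝ (fderiv ℝ X) u v w = fderiv ℝ (fderiv ℝ X) u w v :=
    (hX.isSymmSndFDerivAt (by simp; norm_cast)) v w
  have e : HasFDerivAt (fun a => (Γ (X a)).comp (fderiv ℝ X a)) _ u :=
    (hΓ.hasFDerivAt.comp u hX1).clm_comp hX2
  simp [bundleCurvature, curvatureOf, e.fderiv, hsymm]

variable {ψ : E → E →L[ℝ] F} {ν : E → F} {θ : E → E →L[ℝ] F →L[ℝ] F} {u : E}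
  {Γ : E → E →L[ℝ] E →L[ℝ] E} {B : E → E →L[ℝ] E →L[ℝ] ℝ} {A : E → E →L[ℝ] E}
  {τ : E → E →L[ℝ] ℝ}

/-- The Gauss and Codazzi equations. -/
theorem bundleCurvature_tangent (hθ : DifferentiableAt ℝ θ u) (hψ : ContDiffAt ℝ ∞ ψ u)
    (hν : DifferentiableAt ℝ ν u) (hΓ : DifferentiableAt ℝ Γ u) (hB : DifferentiableAt ℝ B u)
    (gauss : ∀ᶠ y in 𝓝 u, ∀ v w,
      fderiv ℝ ψ y v w + θ y v (ψ y w) = ψ y (Γ y v w) + B y v w • ν y)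
    (weingarten : ∀ v, fderiv ℝ ν u v + θ u v (ν u) = -ψ u (A u v) + τ u v • ν u) (v w z : E) :
    ∃ k : ℝ, bundleCurvature θ u v w (ψ u z) =
      ψ u (curvatureOf Γ u v w z - B u w z • A u v + B u v z • A u w) + k • ν u := by
  have hψ1 := (hψ.differentiableAt (by simp)).hasFDerivAt
  set σ : E → E →L[ℝ] F := fun y => (ψ y).comp ((Γ y).flip z) + ((B y).flip z).smulRight (ν y)
  have hz : ContDiffAt ℝ ∞ (fun y => ψ y z) u := hψ.clm_apply contDiffAt_const
  have hσ : ∀ᶠ y in 𝓝 u, ∀ w, σ y w = fderiv ℝ (fun y => ψ y z) y w + θ y w (ψ y z) := by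
    have h1 : ∀ᶠ y in 𝓝 u, ContDiffAt ℝ 1 ψ y := (hψ.of_le (by simp)).eventually (by simp)
    filter_upwards [gauss, h1] with y hy hy1 w
    have : HasFDerivAt (fun y => ψ y z) _ y :=
      (hy1.differentiableAt one_ne_zero).hasFDerivAt.clm_apply (hasFDerivAt_const z y)
    rw [this.fderiv]
    simpa [σ] using (hy w z).symm
  have a1 := (ContinuousLinearMap.flipₗᵢ ℝ E E E).toContinuousLinearEquiv.hasFDerivAt.comp u
    hΓ.hasFDerivAt
  have a2 := (ContinuousLinearMap.flipₗᵢ ℝ E E ℝ).toContinuousLinearEquiv.hasFDerivAt.comp u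
    hB.hasFDerivAt
  have a3 : HasFDerivAt (fun y => (B y).flip z) _ u := a2.clm_apply (hasFDerivAt_const z u)
  have e : HasFDerivAt σ _ u :=
    (hψ1.clm_comp (a1.clm_apply (hasFDerivAt_const z u))).add
      (((ContinuousLinearMap.smulRightL ℝ E F).hasFDerivAt.comp u a3).clm_apply hν.hasFDerivAt)
  have h := ricci_identity hθ hz hσ v w
  rw [e.fderiv] at h
  rw [← h]
  have g1 := gauss.self_of_nhds v (Γ u w z)
  have g2 := gauss.self_of_nhds w (Γ u v z)
  have w1 := weingarten v
  have w2 := weingarten w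
  -- The witness is the Codazzi expression, the coefficient of ν; it is left existential because
  -- only the tangential part is used later.
  refine ⟨fderiv ℝ B u v w z - fderiv ℝ B u w v z + B u v (Γ u w z) - B u w (Γ u v z)
    + B u w z * τ u v - B u v z * τ u w, ?_⟩
  simp [σ, curvatureOf]
  rw [← sub_eq_zero] at g1 g2 w1 w2 ⊢
  linear_combination (norm := module) g1 - g2 + B u w z • w1 - B u v z • w2

/-- The Ricci equation. -/
theorem bundleCurvature_normal (hθ : DifferentiableAt ℝ θ u) (hψ : DifferentiableAt ℝ ψ u)
    (hν : ContDiffAt ℝ ∞ ν u) (hA : DifferentiableAt ℝ A u) (hτ : DifferentiableAt ℝ τ u)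
    (gauss : ∀ v w, fderiv ℝ ψ u v w + θ u v (ψ u w) = ψ u (Γ u v w) + B u v w • ν u)
    (weingarten : ∀ᶠ y in 𝓝 u, ∀ v,
      fderiv ℝ ν y v + θ y v (ν y) = -ψ y (A y v) + τ y v • ν y) (v w : E) :
    ∃ a : E, bundleCurvature θ u v w (ν u) =
      ψ u a + (fderiv ℝ τ u v w - fderiv ℝ τ u w v - B u v (A u w) + B u w (A u v)) • ν u := by
  have hν1 := (hν.differentiableAt (by simp)).hasFDerivAt
  set σ : E → E →L[ℝ] F := fun y => -(ψ y).comp (A y) + (τ y).smulRight (ν y)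
  have hσ : ∀ᶠ y in 𝓝 u, ∀ w, σ y w = fderiv ℝ ν y w + θ y w (ν y) := by
    filter_upwards [weingarten] with y hy w
    simp [σ, hy w]
  have e : HasFDerivAt σ _ u :=
    (hψ.hasFDerivAt.clm_comp hA.hasFDerivAt).neg.add
      (((ContinuousLinearMap.smulRightL ℝ E F).hasFDerivAt.comp u hτ.hasFDerivAt).clm_apply hν1)
  have h := ricci_identity hθ hν hσ v w
  rw [e.fderiv] at h
  rw [← h]
  have g1 := gauss v (A u w)
  have g2 := gauss w (A u v)
  have w1 := weingarten.self_of_nhds v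
  have w2 := weingarten.self_of_nhds w
  -- The tangential part is existential: later use pairs with ξ, which does not see it.
  refine ⟨-Γ u v (A u w) + Γ u w (A u v) - fderiv ℝ A u v w + fderiv ℝ A u w v
    - τ u w • A u v + τ u v • A u w, ?_⟩
  simp [σ]
  rw [← sub_eq_zero] at g1 g2 w1 w2 ⊢
  linear_combination (norm := module) -g1 + g2 + τ u w • w1 - τ u v • w2

end Curvature

/-! ### Ricci tensor of a connection modified by a tensor times a vector field. -/

section Ricci

set_option maxSynthPendingDepth 3

variable {E : Type*} [NormedAddCommGroup E] [NormedSpace ℝ E] [FiniteDimensional ℝ E]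
  {F : Type*} [NormedAddCommGroup F] [NormedSpace ℝ F] [FiniteDimensional ℝ F]

/-- The effect on the Ricci tensor of adding `S ⊗ ξ` to a connection. -/
theorem ricciOf_add_smul {Γ Γ' : E → E →L[ℝ] E →L[ℝ] E} {S : E → E →L[ℝ] E →L[ℝ] ℝ} {ξ : E → E}
    {u : E} (hΓ : DifferentiableAt ℝ Γ u) (hS : DifferentiableAt ℝ S u)
    (hξ : DifferentiableAt ℝ ξ u)
    (hΓ' : DifferentiableAt ℝ Γ' u)
    (h : ∀ᶠ y in 𝓝 u, ∀ v w, Γ' y v w = Γ y v w + S y v w • ξ y) (z : E) :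
    ricciOf Γ' u (ξ u) z = ricciOf Γ u (ξ u) z
      + S u (ξ u) z * LinearMap.trace ℝ E (fderiv ℝ ξ u + (Γ u).flip (ξ u)).toLinearMap
      - S u (fderiv ℝ ξ u (ξ u) + Γ u (ξ u) (ξ u)) z := by
  have e : ∀ b c a, fderiv ℝ Γ' u a b c =
      fderiv ℝ Γ u a b c + (fderiv ℝ S u a b c • ξ u + S u b c • fderiv ℝ ξ u a) := by
    intro b c a
    have e1 := ((hΓ.hasFDerivAt.clm_apply (hasFDerivAt_const b u)).clm_apply
        (hasFDerivAt_const c u)).add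
      (((hS.hasFDerivAt.clm_apply (hasFDerivAt_const b u)).clm_apply
        (hasFDerivAt_const c u)).smul hξ.hasFDerivAt)
    have e2 := e1.congr_of_eventuallyEq (h.mono fun y hy => hy b c)
    rw [← fderiv_apply_apply hΓ', e2.fderiv]
    simp [add_comm]
  have h0 := h.self_of_nhds
  set φ : E →ₗ[ℝ] E := (fderiv ℝ ξ u + (Γ u).flip (ξ u)).toLinearMap with hφ
  set a : E := fderiv ℝ ξ u (ξ u) + Γ u (ξ u) (ξ u) with ha
  -- `l` collects everything multiplying ξ, including the derivatives of S. It is antisymmetrized in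
  -- v and ξ, so it vanishes at ξ and l ⊗ ξ has trace zero.
  set l : E →L[ℝ] ℝ := ((fderiv ℝ S u).flip (ξ u)).flip z - (fderiv ℝ S u (ξ u)).flip z
    + (S u).flip (Γ u (ξ u) z) - (S u (ξ u)).comp ((Γ u).flip z) + S u (ξ u) z • (S u).flip (ξ u)
    - S u (ξ u) (ξ u) • (S u).flip z with hl
  have key : ∀ v, curvatureOf Γ' u v (ξ u) z = curvatureOf Γ u v (ξ u) z + S u (ξ u) z • φ v
      - S u v z • a + l v • ξ u := by
    intro v
    simp only [curvatureOf, e, h0, hφ, ha, hl]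
    simp
    module
  have hl0 : l (ξ u) = 0 := by
    simp [hl]
    ring
  have hR : ricciOf Γ' u (ξ u) z = LinearMap.trace ℝ E
      ({ toFun := fun X => curvatureOf Γ u X (ξ u) z
         map_add' := by
          intro a b
          simp only [curvatureOf, map_add, add_apply]
          abel
         map_smul' := by
          intro c a
          simp only [curvatureOf, map_smul, smul_apply, RingHom.id_apply, smul_add, smul_sub] } +
        S u (ξ u) z • φ - ((S u).flip z).toLinearMap.smulRight a
        + l.toLinearMap.smulRight (ξ u)) := by
    refine congrArg (LinearMap.trace ℝ E) (LinearMap.ext fun v => ?_)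
    exact key v
  rw [hR, map_add, map_sub, map_add, map_smul, LinearMap.trace_smulRight,
    LinearMap.trace_smulRight]
  change _ + _ - S u a z + l (ξ u) = _
  rw [hl0, add_zero]
  rfl

end Ricci

/-! ### Null hypersurfaces in coordinates: splitting and smoothness. -/

section LocalNull

set_option maxSynthPendingDepth 3

variable {E : Type*} [NormedAddCommGroup E] [NormedSpace ℝ E]
  {F : Type*} [NormedAddCommGroup F] [NormedSpace ℝ F]

/-- The map `(v, b) ↦ dX(v) + b N` in coordinates. -/
def localSplit (X : E → F) (N : F → F) (u : E) : E × ℝ →L[ℝ] F :=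
  (fderiv ℝ X u).coprod ((ContinuousLinearMap.id ℝ ℝ).smulRight (N (X u)))

/-- The projection onto the tangent space along `N`, in coordinates. -/
def localProj (X : E → F) (N : F → F) (u : E) : F →L[ℝ] E :=
  (ContinuousLinearMap.fst ℝ E ℝ).comp (localSplit X N u).inverse

/-- The 1-form `G(N, ·)` pulled back by `X`. -/
def localEta (G : F → F →L[ℝ] F →L[ℝ] ℝ) (X : E → F) (N : F → F) (u : E) : E →L[ℝ] ℝ :=
  (G (X u) (N (X u))).comp (fderiv ℝ X u)

/-- The derivative of the rigging along the hypersurface. -/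
def localDerivRigging (G : F → F →L[ℝ] F →L[ℝ] ℝ) (X : E → F) (N : F → F) (u : E) : E →L[ℝ] F :=
  (fderiv ℝ N (X u) + (christoffel G (X u)).flip (N (X u))).comp (fderiv ℝ X u)

/-- The Hessian `∇ dX` of the map `X` into the space with metric `G`. -/
def hessianAlong (G : F → F →L[ℝ] F →L[ℝ] ℝ) (X : E → F) (u : E) : E →L[ℝ] E →L[ℝ] F :=
  fderiv ℝ (fderiv ℝ X) u + (christoffel G (X u)).bilinearComp (fderiv ℝ X u) (fderiv ℝ X u)

/-- The rotation form in coordinates. -/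
def localRotation (G : F → F →L[ℝ] F →L[ℝ] ℝ) (X : E → F) (N : F → F) (ξ : E → E) (u : E) :
    E →L[ℝ] ℝ :=
  (G (X u) (fderiv ℝ X u (ξ u))).comp (localDerivRigging G X N u)

/-- The shape operator `A_N` in coordinates. -/
def localShape (G : F → F →L[ℝ] F →L[ℝ] ℝ) (X : E → F) (N : F → F) (u : E) : E →L[ℝ] E :=
  -(localProj X N u).comp (localDerivRigging G X N u)

/-- The connection form of the induced connection. -/
def localConnection (G : F → F →L[ℝ] F →L[ℝ] ℝ) (X : E → F) (N : F → F) (u : E) :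
    E →L[ℝ] E →L[ℝ] E :=
  (ContinuousLinearMap.compL ℝ E F E (localProj X N u)).comp (hessianAlong G X u)

/-- The null second fundamental form. -/
def localSecondForm (G : F → F →L[ℝ] F →L[ℝ] ℝ) (X : E → F) (ξ : E → E) (u : E) :
    E →L[ℝ] E →L[ℝ] ℝ :=
  (ContinuousLinearMap.compL ℝ E F ℝ (G (X u) (fderiv ℝ X u (ξ u)))).comp (hessianAlong G X u)

/-- The `α`-associated metric in coordinates. -/
def localAssociated (G : F → F →L[ℝ] F →L[ℝ] ℝ) (X : E → F) (N : F → F) (α : E → ℝ) (u : E) :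
    E →L[ℝ] E →L[ℝ] ℝ :=
  pullBilin (G (X u)) (fderiv ℝ X u) + α u • (localEta G X N u).smulRight (localEta G X N u)

/-- The local picture of a null hypersurface with a null rigging of closed normalization and its
rigged field `ξ`. -/
structure IsLocalNullRigging (G : F → F →L[ℝ] F →L[ℝ] ℝ) (X : E → F) (N : F → F) (ξ : E → E)
    (u : E) : Prop where
  contDiffX : ContDiffAt ℝ ∞ X u
  contDiffG : ContDiffAt ℝ ∞ G (X u)
  contDiffN : ContDiffAt ℝ ∞ N (X u)
  symm : ∀ᶠ y in 𝓝 (X u), ∀ v w, G y v w = G y w v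
  isInvertible : (G (X u)).IsInvertible
  split : (localSplit X N u).IsInvertible
  orth : ∀ v, G (X u) (fderiv ℝ X u (ξ u)) (fderiv ℝ X u v) = 0
  norm : G (X u) (fderiv ℝ X u (ξ u)) (N (X u)) = 1
  null : G (X u) (N (X u)) (N (X u)) = 0
  closed : ∀ v w, fderiv ℝ (localEta G X N) u v w = fderiv ℝ (localEta G X N) u w v

variable {G : F → F →L[ℝ] F →L[ℝ] ℝ} {X : E → F} {N : F → F} {ξ : E → E} {u : E}

theorem hessianAlong_apply (v w : E) : hessianAlong G X u v w =
    fderiv ℝ (fderiv ℝ X) u v w + christoffel G (X u) (fderiv ℝ X u v) (fderiv ℝ X u w) := rfl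

theorem localDerivRigging_apply (v : E) : localDerivRigging G X N u v =
    fderiv ℝ N (X u) (fderiv ℝ X u v) + christoffel G (X u) (fderiv ℝ X u v) (N (X u)) := rfl

theorem localSplit_apply (v : E) (b : ℝ) :
    localSplit X N u (v, b) = fderiv ℝ X u v + b • N (X u) := by
  simp [localSplit]

/-- Derivative of the metric product of two fields along `X`. -/
theorem fderiv_metric_along (hX : DifferentiableAt ℝ X u) (hG : DifferentiableAt ℝ G (X u))
    (hs : ∀ᶠ y in 𝓝 (X u), ∀ v w, G y v w = G y w v) (hinv : (G (X u)).IsInvertible)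
    {s t : E → F} (h_s : DifferentiableAt ℝ s u) (ht : DifferentiableAt ℝ t u) (v : E) :
    fderiv ℝ (fun y => G (X y) (s y) (t y)) u v =
      G (X u) (fderiv ℝ s u v + christoffel G (X u) (fderiv ℝ X u v) (s u)) (t u)
      + G (X u) (s u) (fderiv ℝ t u v + christoffel G (X u) (fderiv ℝ X u v) (t u)) := by
  have e : HasFDerivAt (fun y => G (X y) (s y) (t y)) _ u :=
    ((hG.hasFDerivAt.comp u hX.hasFDerivAt).clm_apply h_s.hasFDerivAt).clm_apply ht.hasFDerivAt
  rw [e.fderiv]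
  simp [fderiv_metric_eq hinv hG hs]
  ring

namespace IsLocalNullRigging

theorem metric_comm (h : IsLocalNullRigging G X N ξ u) (v w : F) :
    G (X u) v w = G (X u) w v := h.symm.self_of_nhds v w

theorem localEta_rigged (h : IsLocalNullRigging G X N ξ u) : localEta G X N u (ξ u) = 1 := by
  rw [← h.norm, h.metric_comm]; rfl

theorem localProj_apply (h : IsLocalNullRigging G X N ξ u) (v : E) (b : ℝ) :
    localProj X N u (fderiv ℝ X u v + b • N (X u)) = v := by
  rw [← localSplit_apply]
  simp [localProj, h.split.inverse_apply_self]

theorem normal_apply (h : IsLocalNullRigging G X N ξ u) (v : E) (b : ℝ) :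
    G (X u) (fderiv ℝ X u (ξ u)) (fderiv ℝ X u v + b • N (X u)) = b := by
  simp [h.orth, h.norm]

/-- Pairing with ξ reads off the N-coefficient, as ξ is orthogonal to TM and g(ξ,N) = 1. -/
theorem decompose (h : IsLocalNullRigging G X N ξ u) (y : F) :
    y = fderiv ℝ X u (localProj X N u y) + G (X u) (fderiv ℝ X u (ξ u)) y • N (X u) := by
  obtain ⟨⟨v, b⟩, rfl⟩ := h.split.surjective y
  rw [localSplit_apply, h.localProj_apply, h.normal_apply]

theorem localProj_tangent (h : IsLocalNullRigging G X N ξ u) (v : E) :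
    localProj X N u (fderiv ℝ X u v) = v := by
  simpa using h.localProj_apply v 0

/-- Such a vector is orthogonal to both TM and N, hence to everything. This is how tangent vectors
are recognized although the induced form is degenerate. -/
theorem eq_zero_of_orth (h : IsLocalNullRigging G X N ξ u) {v : E}
    (h1 : ∀ w, G (X u) (fderiv ℝ X u v) (fderiv ℝ X u w) = 0) (h2 : localEta G X N u v = 0) :
    v = 0 := by
  have : fderiv ℝ X u v = 0 := by
    apply h.isInvertible.injective
    ext y
    rw [h.decompose y, map_add, h1, map_smul, h.metric_comm _ (N (X u))]
    have h3 : G (X u) (N (X u)) (fderiv ℝ X u v) = 0 := h2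
    simp [h3]
  rw [← h.localProj_tangent v, this, map_zero]

variable [FiniteDimensional ℝ E] [FiniteDimensional ℝ F]

omit [FiniteDimensional ℝ E] in
theorem contDiffAt_christoffel (h : IsLocalNullRigging G X N ξ u) :
    ContDiffAt ℝ ∞ (christoffel G) (X u) :=
  NullGeom.contDiffAt_christoffel h.isInvertible h.contDiffG

omit [FiniteDimensional ℝ E] [FiniteDimensional ℝ F] in
theorem contDiffAt_fderiv (h : IsLocalNullRigging G X N ξ u) :
    ContDiffAt ℝ ∞ (fderiv ℝ X) u := h.contDiffX.fderiv_right (by norm_cast)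

omit [FiniteDimensional ℝ E] [FiniteDimensional ℝ F] in
theorem contDiffAt_rigging (h : IsLocalNullRigging G X N ξ u) :
    ContDiffAt ℝ ∞ (fun y => N (X y)) u := h.contDiffN.comp u h.contDiffX

omit [FiniteDimensional ℝ E] [FiniteDimensional ℝ F] in
theorem contDiffAt_metric (h : IsLocalNullRigging G X N ξ u) :
    ContDiffAt ℝ ∞ (fun y => G (X y)) u := h.contDiffG.comp u h.contDiffX

omit [FiniteDimensional ℝ E] [FiniteDimensional ℝ F] in
theorem contDiffAt_localEta (h : IsLocalNullRigging G X N ξ u) :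
    ContDiffAt ℝ ∞ (localEta G X N) u :=
  (h.contDiffAt_metric.clm_apply h.contDiffAt_rigging).clm_comp h.contDiffAt_fderiv

omit [FiniteDimensional ℝ F] in
theorem contDiffAt_localSplit_inverse (h : IsLocalNullRigging G X N ξ u) :
    ContDiffAt ℝ ∞ (fun y => (localSplit X N y).inverse) u := by
  have : CompleteSpace E := FiniteDimensional.complete ℝ E
  refine h.split.contDiffAt_map_inverse.comp u ?_
  -- The `coprod` is rewritten as a sum over the two projections, where smoothness in `y` is
  -- visible.
  have h1 : ContDiffAt ℝ ∞ (fun y => (fderiv ℝ X y).comp (ContinuousLinearMap.fst ℝ E ℝ)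
      + (ContinuousLinearMap.snd ℝ E ℝ).smulRight (N (X y))) u :=
    (h.contDiffAt_fderiv.clm_comp contDiffAt_const).add
      (ContDiffAt.clm_apply contDiffAt_const h.contDiffAt_rigging (f := fun _ =>
        ContinuousLinearMap.smulRightL ℝ (E × ℝ) F (ContinuousLinearMap.snd ℝ E ℝ)))
  convert h1 using 2 with y
  ext <;> simp [localSplit]

omit [FiniteDimensional ℝ F] in
theorem contDiffAt_localProj (h : IsLocalNullRigging G X N ξ u) :
    ContDiffAt ℝ ∞ (localProj X N) u :=
  contDiffAt_const.clm_comp h.contDiffAt_localSplit_inverse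

omit [FiniteDimensional ℝ E] in
theorem contDiffAt_localDerivRigging (h : IsLocalNullRigging G X N ξ u) :
    ContDiffAt ℝ ∞ (localDerivRigging G X N) u := by
  have h1 : ContDiffAt ℝ ∞ (fun y => fderiv ℝ N (X y)) u :=
    (h.contDiffN.fderiv_right (m := ∞) (by norm_cast)).comp u h.contDiffX
  have h2 : ContDiffAt ℝ ∞ (fun y => (christoffel G (X y)).flip) u :=
    (ContinuousLinearMap.flipₗᵢ ℝ F F F).contDiff.contDiffAt.comp u
      (h.contDiffAt_christoffel.comp u h.contDiffX)
  exact (h1.add (h2.clm_apply h.contDiffAt_rigging)).clm_comp h.contDiffAt_fderiv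

/-- The field ξ is given only by pointwise equations. They say that g(ξ,·) is the N-coordinate of
the splitting, so ξ is obtained from smooth data by inverting `G` and projecting. -/
theorem contDiffAt_rigged (h : ∀ᶠ y in 𝓝 u, IsLocalNullRigging G X N ξ y) :
    ContDiffAt ℝ ∞ ξ u := by
  have : CompleteSpace F := FiniteDimensional.complete ℝ F
  have h0 := h.self_of_nhds
  have h2 : ContDiffAt ℝ ∞ (fun y => (G (X y)).inverse) u :=
    ContDiffAt.comp (g := ContinuousLinearMap.inverse) (f := fun y => G (X y)) u
      h0.isInvertible.contDiffAt_map_inverse h0.contDiffAt_metric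
  have h1 : ContDiffAt ℝ ∞ (fun y => localProj X N y ((G (X y)).inverse
      ((ContinuousLinearMap.snd ℝ E ℝ).comp (localSplit X N y).inverse))) u :=
    h0.contDiffAt_localProj.clm_apply
      (h2.clm_apply (contDiffAt_const.clm_comp h0.contDiffAt_localSplit_inverse))
  refine h1.congr_of_eventuallyEq ?_
  filter_upwards [h] with y hy
  have : (ContinuousLinearMap.snd ℝ E ℝ).comp (localSplit X N y).inverse =
      G (X y) (fderiv ℝ X y (ξ y)) := by
    ext z
    obtain ⟨⟨v, b⟩, rfl⟩ := hy.split.surjective z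
    rw [ContinuousLinearMap.comp_apply, hy.split.inverse_apply_self, localSplit_apply]
    simp [hy.orth, hy.norm]
  rw [this, hy.isInvertible.inverse_apply_self, hy.localProj_tangent]

omit [FiniteDimensional ℝ E] in
theorem contDiffAt_hessianAlong (h : IsLocalNullRigging G X N ξ u) :
    ContDiffAt ℝ ∞ (hessianAlong G X) u := by
  have h1 := h.contDiffAt_christoffel.comp u h.contDiffX
  have h2 : ContDiffAt ℝ ∞ (fun y => ((christoffel G (X y)).comp (fderiv ℝ X y)).flip) u :=
    (ContinuousLinearMap.flipₗᵢ ℝ E F F).contDiff.contDiffAt.comp u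
      (h1.clm_comp h.contDiffAt_fderiv)
  have h3 : ContDiffAt ℝ ∞ (fun y => (((christoffel G (X y)).comp (fderiv ℝ X y)).flip.comp
      (fderiv ℝ X y)).flip) u :=
    (ContinuousLinearMap.flipₗᵢ ℝ E E F).contDiff.contDiffAt.comp u
      (h2.clm_comp h.contDiffAt_fderiv)
  exact (h.contDiffAt_fderiv.fderiv_right (m := ∞) (by norm_cast)).add h3

theorem contDiffAt_localConnection (h : IsLocalNullRigging G X N ξ u) :
    ContDiffAt ℝ ∞ (localConnection G X N) u :=
  ((ContinuousLinearMap.compL ℝ E F E).contDiff.contDiffAt.comp u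
    h.contDiffAt_localProj).clm_comp h.contDiffAt_hessianAlong

theorem contDiffAt_localSecondForm (h : ∀ᶠ y in 𝓝 u, IsLocalNullRigging G X N ξ y) :
    ContDiffAt ℝ ∞ (localSecondForm G X ξ) u :=
  ((ContinuousLinearMap.compL ℝ E F ℝ).contDiff.contDiffAt.comp u
    (h.self_of_nhds.contDiffAt_metric.clm_apply (h.self_of_nhds.contDiffAt_fderiv.clm_apply
      (contDiffAt_rigged h)))).clm_comp h.self_of_nhds.contDiffAt_hessianAlong

theorem contDiffAt_localShape (h : IsLocalNullRigging G X N ξ u) :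
    ContDiffAt ℝ ∞ (localShape G X N) u :=
  (h.contDiffAt_localProj.clm_comp h.contDiffAt_localDerivRigging).neg

theorem contDiffAt_localRotation (h : ∀ᶠ y in 𝓝 u, IsLocalNullRigging G X N ξ y) :
    ContDiffAt ℝ ∞ (localRotation G X N ξ) u :=
  (h.self_of_nhds.contDiffAt_metric.clm_apply (h.self_of_nhds.contDiffAt_fderiv.clm_apply
    (contDiffAt_rigged h))).clm_comp h.self_of_nhds.contDiffAt_localDerivRigging

omit [FiniteDimensional ℝ E] [FiniteDimensional ℝ F] in
theorem contDiffAt_localAssociated (h : IsLocalNullRigging G X N ξ u) {α : E → ℝ}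
    (hα : ContDiffAt ℝ ∞ α u) : ContDiffAt ℝ ∞ (localAssociated G X N α) u := by
  have h1 : ContDiffAt ℝ ∞ (fun y => (localEta G X N y).smulRight (localEta G X N y)) u :=
    ((ContinuousLinearMap.smulRightL ℝ E (E →L[ℝ] ℝ)).contDiff.contDiffAt.comp u
      h.contDiffAt_localEta).clm_apply h.contDiffAt_localEta
  exact (ContDiffAt.pullBilin h.contDiffAt_metric h.contDiffAt_fderiv).add (hα.smul h1)

end IsLocalNullRigging

end LocalNull

/-! ### The Ricci formula in coordinates. -/

section LocalTheorem

set_option maxSynthPendingDepth 3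
set_option linter.unusedSectionVars false

variable {E : Type*} [NormedAddCommGroup E] [NormedSpace ℝ E] [FiniteDimensional ℝ E]
  {F : Type*} [NormedAddCommGroup F] [NormedSpace ℝ F] [FiniteDimensional ℝ F]
  {G : F → F →L[ℝ] F →L[ℝ] ℝ} {X : E → F} {N : F → F} {ξ : E → E} {u : E}

/-- The derivative of the rigged field along the hypersurface. -/
def localDerivRigged (G : F → F →L[ℝ] F →L[ℝ] ℝ) (X : E → F) (ξ : E → E) (u : E) : E →L[ℝ] F :=
  fderiv ℝ (fun y => fderiv ℝ X y (ξ y)) u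
    + ((christoffel G (X u)).flip (fderiv ℝ X u (ξ u))).comp (fderiv ℝ X u)

/-- The screen shape operator in coordinates. -/
def localScreenShape (G : F → F →L[ℝ] F →L[ℝ] ℝ) (X : E → F) (N : F → F) (ξ : E → E) (u : E) :
    E →L[ℝ] E :=
  -((localProj X N u).comp (localDerivRigged G X ξ u))
    - (localRotation G X N ξ u).smulRight (ξ u)

namespace IsLocalNullRigging

theorem localDerivRigged_apply (v : E) : localDerivRigged G X ξ u v =
    fderiv ℝ (fun y => fderiv ℝ X y (ξ y)) u v
      + christoffel G (X u) (fderiv ℝ X u v) (fderiv ℝ X u (ξ u)) := rfl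

theorem hessianAlong_symm (h : IsLocalNullRigging G X N ξ u) (v w : E) :
    hessianAlong G X u v w = hessianAlong G X u w v := by
  have h1 : fderiv ℝ (fderiv ℝ X) u v w = fderiv ℝ (fderiv ℝ X) u w v :=
    (h.contDiffX.isSymmSndFDerivAt (by simp; norm_cast)) v w
  rw [hessianAlong_apply, hessianAlong_apply, h1,
    christoffel_symm (h.contDiffG.differentiableAt (by simp)) h.symm]

theorem gauss (h : IsLocalNullRigging G X N ξ u) (v w : E) :
    hessianAlong G X u v w = fderiv ℝ X u (localConnection G X N u v w)
      + localSecondForm G X ξ u v w • N (X u) := h.decompose _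

theorem weingarten (h : IsLocalNullRigging G X N ξ u) (v : E) :
    localDerivRigging G X N u v = -fderiv ℝ X u (localShape G X N u v)
      + localRotation G X N ξ u v • N (X u) := by
  rw [localShape, neg_apply, map_neg, neg_neg]
  exact h.decompose (localDerivRigging G X N u v)

theorem localSecondForm_symm (h : IsLocalNullRigging G X N ξ u) (v w : E) :
    localSecondForm G X ξ u v w = localSecondForm G X ξ u w v :=
  congrArg (G (X u) (fderiv ℝ X u (ξ u))) (h.hessianAlong_symm v w)

theorem localConnection_symm (h : IsLocalNullRigging G X N ξ u) (v w : E) :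
    localConnection G X N u v w = localConnection G X N u w v :=
  congrArg (localProj X N u) (h.hessianAlong_symm v w)

theorem fderiv_along (h : IsLocalNullRigging G X N ξ u) {s t : E → F}
    (hs : DifferentiableAt ℝ s u) (ht : DifferentiableAt ℝ t u) (v : E) :
    fderiv ℝ (fun y => G (X y) (s y) (t y)) u v =
      G (X u) (fderiv ℝ s u v + christoffel G (X u) (fderiv ℝ X u v) (s u)) (t u)
      + G (X u) (s u) (fderiv ℝ t u v + christoffel G (X u) (fderiv ℝ X u v) (t u)) :=
  fderiv_metric_along (h.contDiffX.differentiableAt (by simp))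
    (h.contDiffG.differentiableAt (by simp)) h.symm h.isInvertible hs ht v

theorem differentiableAt_tangent (h : IsLocalNullRigging G X N ξ u) (w : E) :
    DifferentiableAt ℝ (fun y => fderiv ℝ X y w) u :=
  (h.contDiffAt_fderiv.differentiableAt (by simp)).clm_apply (differentiableAt_const w)

theorem fderiv_tangent (h : IsLocalNullRigging G X N ξ u) (v w : E) :
    fderiv ℝ (fun y => fderiv ℝ X y w) u v
      + christoffel G (X u) (fderiv ℝ X u v) (fderiv ℝ X u w) = hessianAlong G X u v w := by
  have e : HasFDerivAt (fun y => fderiv ℝ X y w) _ u :=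
    (h.contDiffAt_fderiv.differentiableAt (by simp)).hasFDerivAt.clm_apply (hasFDerivAt_const w u)
  rw [e.fderiv, hessianAlong_apply]
  simp

theorem differentiableAt_rigging (h : IsLocalNullRigging G X N ξ u) :
    DifferentiableAt ℝ (fun y => N (X y)) u := h.contDiffAt_rigging.differentiableAt (by simp)

theorem fderiv_rigging (h : IsLocalNullRigging G X N ξ u) (v : E) :
    fderiv ℝ (fun y => N (X y)) u v
      + christoffel G (X u) (fderiv ℝ X u v) (N (X u)) = localDerivRigging G X N u v := by
  have e : HasFDerivAt (fun y => N (X y)) _ u :=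
    (h.contDiffN.differentiableAt (by simp)).hasFDerivAt.comp u
      (h.contDiffX.differentiableAt (by simp)).hasFDerivAt
  rw [e.fderiv, localDerivRigging_apply]
  simp

theorem differentiableAt_rigged (h : ∀ᶠ y in 𝓝 u, IsLocalNullRigging G X N ξ y) :
    DifferentiableAt ℝ (fun y => fderiv ℝ X y (ξ y)) u :=
  (h.self_of_nhds.contDiffAt_fderiv.clm_apply (contDiffAt_rigged h)).differentiableAt (by simp)

theorem localDerivRigged_eq (h : ∀ᶠ y in 𝓝 u, IsLocalNullRigging G X N ξ y) (v : E) :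
    localDerivRigged G X ξ u v = hessianAlong G X u v (ξ u) + fderiv ℝ X u (fderiv ℝ ξ u v) := by
  have e : HasFDerivAt (fun y => fderiv ℝ X y (ξ y)) _ u :=
    (h.self_of_nhds.contDiffAt_fderiv.differentiableAt (by simp)).hasFDerivAt.clm_apply
      ((contDiffAt_rigged h).differentiableAt (by simp)).hasFDerivAt
  rw [localDerivRigged_apply, e.fderiv, hessianAlong_apply]
  simp
  abel

/-- Differentiate g(ξ, ∂_w X) = 0 in the direction v. -/
theorem metric_localDerivRigged_tangent (h : ∀ᶠ y in 𝓝 u, IsLocalNullRigging G X N ξ y)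
    (v w : E) : G (X u) (localDerivRigged G X ξ u v) (fderiv ℝ X u w) =
      -localSecondForm G X ξ u v w := by
  have h0 := h.self_of_nhds
  have e : (fun y => G (X y) (fderiv ℝ X y (ξ y)) (fderiv ℝ X y w)) =ᶠ[𝓝 u] fun _ => 0 :=
    h.mono fun y hy => hy.orth w
  have e2 := h0.fderiv_along (differentiableAt_rigged h) (h0.differentiableAt_tangent w) v
  rw [e.fderiv_eq, h0.fderiv_tangent, ← localDerivRigged_apply, fderiv_fun_const] at e2
  exact eq_neg_of_add_eq_zero_left e2.symm

/-- Differentiate g(ξ, N) = 1. -/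
theorem metric_localDerivRigged_rigging (h : ∀ᶠ y in 𝓝 u, IsLocalNullRigging G X N ξ y)
    (v : E) : G (X u) (localDerivRigged G X ξ u v) (N (X u)) = -localRotation G X N ξ u v := by
  have h0 := h.self_of_nhds
  have e : (fun y => G (X y) (fderiv ℝ X y (ξ y)) (N (X y))) =ᶠ[𝓝 u] fun _ => 1 :=
    h.mono fun y hy => hy.norm
  have e2 := h0.fderiv_along (differentiableAt_rigged h) h0.differentiableAt_rigging v
  rw [e.fderiv_eq, h0.fderiv_rigging, ← localDerivRigged_apply, fderiv_fun_const] at e2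
  exact eq_neg_of_add_eq_zero_left e2.symm

/-- Differentiating g(ξ, ξ) = 0 gives 2 g(∇_v ξ, ξ) = 0, and this pairing is −B(v, ξ). -/
theorem localSecondForm_rigged (h : ∀ᶠ y in 𝓝 u, IsLocalNullRigging G X N ξ y) (v : E) :
    localSecondForm G X ξ u v (ξ u) = 0 := by
  have h0 := h.self_of_nhds
  have e : (fun y => G (X y) (fderiv ℝ X y (ξ y)) (fderiv ℝ X y (ξ y))) =ᶠ[𝓝 u] fun _ => 0 :=
    h.mono fun y hy => hy.orth _
  have e2 := h0.fderiv_along (differentiableAt_rigged h) (differentiableAt_rigged h) v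
  rw [e.fderiv_eq, ← localDerivRigged_apply, fderiv_fun_const, h0.metric_comm (fderiv ℝ X u (ξ u)),
    metric_localDerivRigged_tangent h] at e2
  simp at e2
  linarith

theorem localProj_localDerivRigged (h : ∀ᶠ y in 𝓝 u, IsLocalNullRigging G X N ξ y) (v : E) :
    localProj X N u (localDerivRigged G X ξ u v) =
      fderiv ℝ ξ u v + localConnection G X N u v (ξ u) := by
  rw [localDerivRigged_eq h, map_add, h.self_of_nhds.localProj_tangent, add_comm]
  rfl

/-- The ambient derivative of ξ has N-component −B(v, ξ) = 0, so the projection loses nothing. -/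
theorem tangent_covDeriv_rigged (h : ∀ᶠ y in 𝓝 u, IsLocalNullRigging G X N ξ y) (v : E) :
    fderiv ℝ X u (fderiv ℝ ξ u v + localConnection G X N u v (ξ u)) =
      localDerivRigged G X ξ u v := by
  have h1 := h.self_of_nhds.decompose (localDerivRigged G X ξ u v)
  rw [localProj_localDerivRigged h, h.self_of_nhds.metric_comm,
    metric_localDerivRigged_tangent h, localSecondForm_rigged h] at h1
  simpa using h1.symm

/-- The rigged field is pre-geodesic. -/
theorem covDeriv_rigged_rigged (h : ∀ᶠ y in 𝓝 u, IsLocalNullRigging G X N ξ y) :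
    fderiv ℝ ξ u (ξ u) + localConnection G X N u (ξ u) (ξ u) =
      -localRotation G X N ξ u (ξ u) • ξ u := by
  have h0 := h.self_of_nhds
  rw [neg_smul, ← add_eq_zero_iff_eq_neg]
  -- The vector ∇_ξ ξ + τ(ξ)ξ is orthogonal to TM because B(ξ,·) = 0, and η annihilates it because
  -- g(∇_ξ ξ, N) = −τ(ξ).
  apply h0.eq_zero_of_orth
  · intro w
    rw [map_add, tangent_covDeriv_rigged h, map_add, add_apply, metric_localDerivRigged_tangent h,
      h0.localSecondForm_symm, localSecondForm_rigged h, map_smul, map_smul, smul_apply, h0.orth]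
    simp
  · have := metric_localDerivRigged_rigging h (ξ u)
    rw [← tangent_covDeriv_rigged h, h0.metric_comm] at this
    rw [map_add, map_smul, h0.localEta_rigged]
    refine (congrArg (· + _) this).trans ?_
    simp

/-- By definition ∇ξ = −A*_ξ − τ ⊗ ξ, and the rank-one term has trace τ(ξ). -/
theorem trace_covDeriv_rigged (h : ∀ᶠ y in 𝓝 u, IsLocalNullRigging G X N ξ y) :
    LinearMap.trace ℝ E (fderiv ℝ ξ u + (localConnection G X N u).flip (ξ u)).toLinearMap =
      -LinearMap.trace ℝ E (localScreenShape G X N ξ u).toLinearMap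
        - localRotation G X N ξ u (ξ u) := by
  have e : (localScreenShape G X N ξ u).toLinearMap =
      -(fderiv ℝ ξ u + (localConnection G X N u).flip (ξ u)).toLinearMap
        - (localRotation G X N ξ u).toLinearMap.smulRight (ξ u) := by
    ext v
    have := localProj_localDerivRigged h v
    simp [localScreenShape, this]
  rw [e, map_sub, map_neg, LinearMap.trace_smulRight]
  simp

/-- This is (∇_v η)(w) = g(∇_v N, w): the Gauss term B(v,w) g(N,N) drops since N is null. Hence
closedness of η is symmetry of g(∇_v N, w). -/
theorem fderiv_localEta (h : IsLocalNullRigging G X N ξ u) (v w : E) :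
    fderiv ℝ (localEta G X N) u v w = G (X u) (localDerivRigging G X N u v) (fderiv ℝ X u w)
      + localEta G X N u (localConnection G X N u v w) := by
  have e1 : HasFDerivAt (fun y => localEta G X N y w) _ u :=
    (h.contDiffAt_localEta.differentiableAt (by simp)).hasFDerivAt.clm_apply
      (hasFDerivAt_const w u)
  have e2 := h.fderiv_along h.differentiableAt_rigging (h.differentiableAt_tangent w) v
  have e3 : fderiv ℝ (fun y => localEta G X N y w) u v = _ := e2
  have e4 : fderiv ℝ (fun y => localEta G X N y w) u v = fderiv ℝ (localEta G X N) u v w := by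
    rw [e1.fderiv]
    simp
  rw [e4, h.fderiv_rigging, h.fderiv_tangent, h.gauss, map_add, map_smul, h.null, smul_zero,
    add_zero] at e3
  exact e3

theorem isInvertible_localAssociated (h : IsLocalNullRigging G X N ξ u) {α : E → ℝ}
    (hα : α u ≠ 0) : (localAssociated G X N α u).IsInvertible := by
  apply isInvertible_of_nondegenerate
  intro v hv
  have hv' : ∀ w, G (X u) (fderiv ℝ X u v) (fderiv ℝ X u w)
      + α u * (localEta G X N u v * localEta G X N u w) = 0 := hv
  -- Pairing with ξ kills the degenerate part and isolates α η(v).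
  have h1 : localEta G X N u v = 0 := by
    have := hv' (ξ u)
    rw [h.metric_comm, h.orth, h.localEta_rigged] at this
    simpa [hα] using this
  exact h.eq_zero_of_orth (fun w => by simpa [h1] using hv' w) h1

/-- The difference of the Levi-Civita connection of the associated metric and the induced
connection is a multiple of the rigged field. -/
theorem christoffel_localAssociated (h : ∀ᶠ y in 𝓝 u, IsLocalNullRigging G X N ξ y) {α : E → ℝ}
    (hα : ContDiffAt ℝ ∞ α u) (hα0 : α u ≠ 0)
    (hαη : ∀ v, localEta G X N u v = 0 → fderiv ℝ α u v = 0) (v w : E) :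
    christoffel (localAssociated G X N α) u v w = localConnection G X N u v w
      + ((α u)⁻¹ * localSecondForm G X ξ u v w
        + G (X u) (localDerivRigging G X N u v) (fderiv ℝ X u w)
        + fderiv ℝ α u (ξ u) / (2 * α u) * (localEta G X N u v * localEta G X N u w)) • ξ u := by
  have h0 := h.self_of_nhds
  have hηξ := h0.localEta_rigged
  -- Since v − η(v)ξ lies in ker η, dα is the multiple dα(ξ) of η.
  have hdα : ∀ v, fderiv ℝ α u v = fderiv ℝ α u (ξ u) * localEta G X N u v := by
    intro v
    have := hαη (v - localEta G X N u v • ξ u) (by simp [hηξ])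
    rw [map_sub, map_smul, sub_eq_zero] at this
    rw [this, smul_eq_mul, mul_comm]
  -- Closedness enters here: the torsion-free part of dη cancels and C is symmetric.
  have hC : ∀ v w, G (X u) (localDerivRigging G X N u v) (fderiv ℝ X u w) =
      G (X u) (localDerivRigging G X N u w) (fderiv ℝ X u v) := by
    intro v w
    have := h0.closed v w
    rw [h0.fderiv_localEta, h0.fderiv_localEta, h0.localConnection_symm] at this
    exact add_right_cancel this
  have happ : ∀ y a b, localAssociated G X N α y a b =
      G (X y) (fderiv ℝ X y a) (fderiv ℝ X y b)
        + α y * (localEta G X N y a * localEta G X N y b) := fun _ _ _ => rfl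
  -- As g_α(ξ,z) = α η(z), the B-term repairs the failure of ∇ to preserve g, and the other terms
  -- account for the derivatives of η and α.
  rw [christoffel_eq_of_symm_of_metric (h0.isInvertible_localAssociated hα0) _ (fun v w =>
    localConnection G X N u v w
      + ((α u)⁻¹ * localSecondForm G X ξ u v w
        + G (X u) (localDerivRigging G X N u v) (fderiv ℝ X u w)
        + fderiv ℝ α u (ξ u) / (2 * α u) * (localEta G X N u v * localEta G X N u w)) • ξ u)]
  · intro a b
    simp only [h0.localConnection_symm a b, h0.localSecondForm_symm a b, hC a b,
      mul_comm (localEta G X N u a)]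
  · intro a b c
    have d1 : DifferentiableAt ℝ (fun y => G (X y) (fderiv ℝ X y b) (fderiv ℝ X y c)) u :=
      ((h0.contDiffAt_metric.differentiableAt (by simp)).clm_apply
        (h0.differentiableAt_tangent b)).clm_apply (h0.differentiableAt_tangent c)
    have d2 := (h0.contDiffAt_localEta.differentiableAt (by simp)).hasFDerivAt
    have e1 : HasFDerivAt (fun y => localAssociated G X N α y b c) _ u :=
      d1.hasFDerivAt.add ((hα.differentiableAt (by simp)).hasFDerivAt.mul ((d2.clm_apply (hasFDerivAt_const b u)).mul
        (d2.clm_apply (hasFDerivAt_const c u))))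
    have d3 : DifferentiableAt ℝ (localAssociated G X N α) u :=
      (h0.contDiffAt_localAssociated hα).differentiableAt (by simp)
    rw [← fderiv_apply_apply d3, e1.fderiv]
    simp [h0.fderiv_along (h0.differentiableAt_tangent b) (h0.differentiableAt_tangent c),
      h0.fderiv_tangent, happ, h0.orth, h0.fderiv_localEta, hηξ, hdα a, h0.gauss]
    have g1 : ∀ y, G (X u) (N (X u)) (fderiv ℝ X u y) = localEta G X N u y := fun _ => rfl
    rw [h0.metric_comm (fderiv ℝ X u b) (N (X u)), h0.metric_comm _ (fderiv ℝ X u (ξ u)), h0.orth,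
      g1, g1]
    field_simp
    ring
  · intro a b
    rw [happ, happ, h0.metric_comm]
    ring

/-- Write the identity as projection to TM plus g(ξ,·)N and use cyclicity of the trace; the
N-direction contributes one diagonal entry. -/
theorem trace_eq (h : IsLocalNullRigging G X N ξ u) (f : F →ₗ[ℝ] F) :
    LinearMap.trace ℝ F f =
      LinearMap.trace ℝ E ((localProj X N u).toLinearMap ∘ₗ f ∘ₗ (fderiv ℝ X u).toLinearMap)
        + G (X u) (fderiv ℝ X u (ξ u)) (f (N (X u))) := by
  have e : f = (f ∘ₗ (fderiv ℝ X u).toLinearMap) ∘ₗ (localProj X N u).toLinearMap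
      + (G (X u) (fderiv ℝ X u (ξ u))).toLinearMap.smulRight (f (N (X u))) := by
    ext y
    conv_lhs => rw [h.decompose y]
    simp
  conv_lhs => rw [e, map_add, LinearMap.trace_comp_comm', LinearMap.trace_smulRight]
  rfl

/-- By Gauss, the tangential trace of the ambient curvature differs from Ric of ∇ by B(A_N ξ, z).
The remaining N-entry of the ambient trace contains the same B-term with the opposite sign, besides
−dτ(ξ, z), so only dτ survives. -/
theorem ricciOf_localConnection (h : ∀ᶠ y in 𝓝 u, IsLocalNullRigging G X N ξ y) (z : E) :
    ricciOf (localConnection G X N) u (ξ u) z =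
      ricciOf (christoffel G) (X u) (fderiv ℝ X u (ξ u)) (fderiv ℝ X u z)
        + (fderiv ℝ (localRotation G X N ξ) u (ξ u) z
          - fderiv ℝ (localRotation G X N ξ) u z (ξ u)) := by
  have h0 := h.self_of_nhds
  have hΓ : DifferentiableAt ℝ (christoffel G) (X u) :=
    h0.contDiffAt_christoffel.differentiableAt (by simp)
  have hθ : DifferentiableAt ℝ (fun a => (christoffel G (X a)).comp (fderiv ℝ X a)) u :=
    ((h0.contDiffAt_christoffel.comp u h0.contDiffX).clm_comp
      h0.contDiffAt_fderiv).differentiableAt (by simp)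
  have hgauss : ∀ᶠ y in 𝓝 u, ∀ v w, fderiv ℝ (fderiv ℝ X) y v w
      + ((christoffel G (X y)).comp (fderiv ℝ X y)) v (fderiv ℝ X y w) =
      fderiv ℝ X y (localConnection G X N y v w) + localSecondForm G X ξ y v w • N (X y) :=
    h.mono fun y hy v w => hy.gauss v w
  have hwein : ∀ᶠ y in 𝓝 u, ∀ v, fderiv ℝ (fun y => N (X y)) y v
      + ((christoffel G (X y)).comp (fderiv ℝ X y)) v (N (X y)) =
      -fderiv ℝ X y (localShape G X N y v) + localRotation G X N ξ y v • N (X y) :=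
    h.mono fun y hy v => (hy.fderiv_rigging v).trans (hy.weingarten v)
  have hBξ : ∀ w, localSecondForm G X ξ u (ξ u) w = 0 := fun w => by
    rw [h0.localSecondForm_symm, localSecondForm_rigged h]
  have k1 : ∀ v, curvatureOf (localConnection G X N) u v (ξ u) z =
      localProj X N u (curvatureOf (christoffel G) (X u) (fderiv ℝ X u v) (fderiv ℝ X u (ξ u))
        (fderiv ℝ X u z)) - localSecondForm G X ξ u v z • localShape G X N u (ξ u) := by
    intro v
    obtain ⟨k, hk⟩ := bundleCurvature_tangent hθ h0.contDiffAt_fderiv h0.differentiableAt_rigging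
      (h0.contDiffAt_localConnection.differentiableAt (by simp))
      ((contDiffAt_localSecondForm h).differentiableAt (by simp)) hgauss hwein.self_of_nhds
      v (ξ u) z
    rw [bundleCurvature_pullback hΓ h0.contDiffX] at hk
    rw [hk, h0.localProj_apply, hBξ]
    simp
  have k2 : G (X u) (fderiv ℝ X u (ξ u)) (curvatureOf (christoffel G) (X u) (N (X u))
      (fderiv ℝ X u (ξ u)) (fderiv ℝ X u z)) =
      fderiv ℝ (localRotation G X N ξ) u z (ξ u) - fderiv ℝ (localRotation G X N ξ) u (ξ u) z
        - localSecondForm G X ξ u z (localShape G X N u (ξ u)) := by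
    obtain ⟨a, ha⟩ := bundleCurvature_normal hθ (h0.contDiffAt_fderiv.differentiableAt (by simp))
      h0.contDiffAt_rigging (h0.contDiffAt_localShape.differentiableAt (by simp))
      ((contDiffAt_localRotation h).differentiableAt (by simp)) hgauss.self_of_nhds hwein z (ξ u)
    rw [bundleCurvature_pullback hΓ h0.contDiffX] at ha
    -- Pair symmetry turns g(R(N,ξ)z, ξ) into g(R(z,ξ)N, ξ), with both directions tangent, so the
    -- Ricci equation applies.
    rw [h0.metric_comm, curvatureOf_pair_symm h0.isInvertible h0.contDiffG h0.symm,
      h0.metric_comm, ha, h0.normal_apply, hBξ]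
    ring
  have e : ricciOf (localConnection G X N) u (ξ u) z = LinearMap.trace ℝ E
      ((localProj X N u).toLinearMap ∘ₗ
        { toFun := fun Y => curvatureOf (christoffel G) (X u) Y (fderiv ℝ X u (ξ u))
            (fderiv ℝ X u z)
          map_add' := by
            intro a b
            simp only [curvatureOf, map_add, add_apply]
            abel
          map_smul' := by
            intro c a
            simp only [curvatureOf, map_smul, smul_apply, RingHom.id_apply, smul_add, smul_sub] }
        ∘ₗ (fderiv ℝ X u).toLinearMap
      - ((localSecondForm G X ξ u).flip z).toLinearMap.smulRight (localShape G X N u (ξ u))) :=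
    congrArg (LinearMap.trace ℝ E) (LinearMap.ext fun v => k1 v)
  rw [e, map_sub, LinearMap.trace_smulRight, eq_sub_of_add_eq (h0.trace_eq _).symm]
  change ricciOf (christoffel G) (X u) _ _ - G (X u) _ (curvatureOf _ _ _ _ _)
    - localSecondForm G X ξ u (localShape G X N u (ξ u)) z = _
  rw [k2, h0.localSecondForm_symm (localShape G X N u (ξ u))]
  ring

/-- The Ricci curvature of the associated metric in the direction of the rigged field. -/
theorem ricciOf_localAssociated (h : ∀ᶠ y in 𝓝 u, IsLocalNullRigging G X N ξ y) {α : E → ℝ}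
    (hα : ∀ᶠ y in 𝓝 u, ContDiffAt ℝ ∞ α y) (hα0 : α u ≠ 0)
    (hαη : ∀ᶠ y in 𝓝 u, ∀ v, localEta G X N y v = 0 → fderiv ℝ α y v = 0) (z : E) :
    ricciOf (christoffel (localAssociated G X N α)) u (ξ u) z =
      ricciOf (christoffel G) (X u) (fderiv ℝ X u (ξ u)) (fderiv ℝ X u z)
        + (fderiv ℝ (localRotation G X N ξ) u (ξ u) z
          - fderiv ℝ (localRotation G X N ξ) u z (ξ u))
        - LinearMap.trace ℝ E (localScreenShape G X N ξ u).toLinearMap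
          * (-G (X u) (fderiv ℝ X u (localShape G X N u (ξ u))) (fderiv ℝ X u z)
            + (localRotation G X N ξ u (ξ u) + fderiv ℝ α u (ξ u) / (2 * α u))
              * localEta G X N u z) := by
  have h0 := h.self_of_nhds
  have hΓα : DifferentiableAt ℝ (christoffel (localAssociated G X N α)) u :=
    (NullGeom.contDiffAt_christoffel (h0.isInvertible_localAssociated hα0)
      (h0.contDiffAt_localAssociated hα.self_of_nhds)).differentiableAt (by simp)
  have hΓ : DifferentiableAt ℝ (localConnection G X N) u :=
    h0.contDiffAt_localConnection.differentiableAt (by simp)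
  have hη : DifferentiableAt ℝ (localEta G X N) u :=
    h0.contDiffAt_localEta.differentiableAt (by simp)
  -- S is defined as η of the difference of the connections, so its differentiability is inherited;
  -- η(ξ) = 1 recovers the explicit coefficient.
  set S : E → E →L[ℝ] E →L[ℝ] ℝ := fun y => (ContinuousLinearMap.compL ℝ E E ℝ
    (localEta G X N y)).comp (christoffel (localAssociated G X N α) y - localConnection G X N y)
  have hS : DifferentiableAt ℝ S u :=
    ((ContinuousLinearMap.compL ℝ E E ℝ).differentiableAt.comp u hη).clm_comp (hΓα.sub hΓ)
  have hev : ∀ᶠ y in 𝓝 u, ∀ v w, christoffel (localAssociated G X N α) y v w =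
      localConnection G X N y v w + S y v w • ξ y := by
    filter_upwards [h.eventually_nhds, hα, hα.self_of_nhds.continuousAt.eventually_ne hα0, hαη]
      with y h1 h2 h3 h4 v w
    have := christoffel_localAssociated h1 h2 h3 h4 v w
    simp [S, this, h1.self_of_nhds.localEta_rigged]
  have hSξ : S u (ξ u) z = -G (X u) (fderiv ℝ X u (localShape G X N u (ξ u))) (fderiv ℝ X u z)
      + (localRotation G X N ξ u (ξ u) + fderiv ℝ α u (ξ u) / (2 * α u))
        * localEta G X N u z := by
    have := christoffel_localAssociated h hα.self_of_nhds hα0 hαη.self_of_nhds (ξ u) z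
    have g1 : G (X u) (N (X u)) (fderiv ℝ X u z) = localEta G X N u z := rfl
    simp [S, this, h0.localEta_rigged, h0.localSecondForm_symm (ξ u), localSecondForm_rigged h,
      h0.weingarten, g1]
    ring
  -- The term −S(∇_ξ ξ, z) = τ(ξ) S(ξ,z) cancels the −τ(ξ) in tr ∇ξ.
  rw [ricciOf_add_smul hΓ hS ((contDiffAt_rigged h).differentiableAt (by simp)) hΓα hev,
    covDeriv_rigged_rigged h, trace_covDeriv_rigged h, map_smul, smul_apply,
    ricciOf_localConnection h, hSξ, smul_eq_mul]
  ring

end IsLocalNullRigging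

end LocalTheorem

/-! ### Coordinate expressions of maps, fields and metrics, and their smoothness. -/

section Charts

set_option maxSynthPendingDepth 3
set_option linter.unusedSectionVars false

variable {E : Type*} [NormedAddCommGroup E] [NormedSpace ℝ E]
  {F : Type*} [NormedAddCommGroup F] [NormedSpace ℝ F]
  {M : Type*} [TopologicalSpace M] [ChartedSpace E M] [IsManifold 𝓘(ℝ, E) ∞ M]
  {M' : Type*} [TopologicalSpace M'] [ChartedSpace F M'] [IsManifold 𝓘(ℝ, F) ∞ M']

/-- The derivative of the chart at `p`, as an endomorphism of the model space. -/
def chartDeriv (p q : M) : E →L[ℝ] E := mfderiv 𝓘(ℝ, E) 𝓘(ℝ, E) (extChartAt 𝓘(ℝ, E) p) q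

/-- The derivative of the inverse of the chart at `p`, as an endomorphism of the model space. -/
def chartSymmDeriv (p : M) (u : E) : E →L[ℝ] E :=
  mfderiv 𝓘(ℝ, E) 𝓘(ℝ, E) (extChartAt 𝓘(ℝ, E) p).symm u

/-- The derivative of a map of manifolds, as a map of model spaces. -/
def modelDeriv (f : M → M') (q : M) : E →L[ℝ] F := mfderiv 𝓘(ℝ, E) 𝓘(ℝ, F) f q

theorem isManifold_one : IsManifold 𝓘(ℝ, E) 1 M := IsManifold.of_le (n := ∞) (by simp)

theorem chartDeriv_self (p : M) : chartDeriv p p = ContinuousLinearMap.id ℝ E := by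
  have : IsManifold 𝓘(ℝ, E) 1 M := isManifold_one
  exact mfderiv_extChartAt_self

theorem chartDeriv_comp_chartSymmDeriv {p : M} {u : E}
    (hu : u ∈ (extChartAt 𝓘(ℝ, E) p).target) :
    (chartDeriv p ((extChartAt 𝓘(ℝ, E) p).symm u)).comp (chartSymmDeriv p u) =
      ContinuousLinearMap.id ℝ E := by
  have : IsManifold 𝓘(ℝ, E) 1 M := isManifold_one
  have := mfderiv_extChartAt_comp_mfderivWithin_extChartAt_symm (I := 𝓘(ℝ, E)) hu
  simp only [modelWithCornersSelf_coe, Set.range_id, mfderivWithin_univ] at this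
  exact this

theorem chartSymmDeriv_comp_chartDeriv {p : M} {u : E}
    (hu : u ∈ (extChartAt 𝓘(ℝ, E) p).target) :
    (chartSymmDeriv p u).comp (chartDeriv p ((extChartAt 𝓘(ℝ, E) p).symm u)) =
      ContinuousLinearMap.id ℝ E := by
  have : IsManifold 𝓘(ℝ, E) 1 M := isManifold_one
  have := mfderivWithin_extChartAt_symm_comp_mfderiv_extChartAt (I := 𝓘(ℝ, E)) hu
  simp only [modelWithCornersSelf_coe, Set.range_id, mfderivWithin_univ] at this
  exact this

theorem mdifferentiableAt_extChartAt_symm {p : M} {u : E}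
    (hu : u ∈ (extChartAt 𝓘(ℝ, E) p).target) :
    MDifferentiableAt 𝓘(ℝ, E) 𝓘(ℝ, E) (extChartAt 𝓘(ℝ, E) p).symm u := by
  have : IsManifold 𝓘(ℝ, E) 1 M := isManifold_one
  have := mdifferentiableWithinAt_extChartAt_symm (I := 𝓘(ℝ, E)) hu
  simpa [mdifferentiableWithinAt_univ] using this

theorem contMDiffAt_extChartAt_symm {p : M} {u : E}
    (hu : u ∈ (extChartAt 𝓘(ℝ, E) p).target) :
    ContMDiffAt 𝓘(ℝ, E) 𝓘(ℝ, E) ∞ (extChartAt 𝓘(ℝ, E) p).symm u :=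
  (contMDiffOn_extChartAt_symm p).contMDiffAt ((isOpen_extChartAt_target p).mem_nhds hu)

theorem fderiv_coordinates {f : M → M'} {a : M} {b : M'} {u : E}
    (hu : u ∈ (extChartAt 𝓘(ℝ, E) a).target)
    (hf : MDifferentiableAt 𝓘(ℝ, E) 𝓘(ℝ, F) f ((extChartAt 𝓘(ℝ, E) a).symm u))
    (hb : f ((extChartAt 𝓘(ℝ, E) a).symm u) ∈ (extChartAt 𝓘(ℝ, F) b).source) :
    fderiv ℝ (fun y => extChartAt 𝓘(ℝ, F) b (f ((extChartAt 𝓘(ℝ, E) a).symm y))) u =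
      (chartDeriv b (f ((extChartAt 𝓘(ℝ, E) a).symm u))).comp
        ((modelDeriv f ((extChartAt 𝓘(ℝ, E) a).symm u)).comp (chartSymmDeriv a u)) := by
  have : IsManifold 𝓘(ℝ, F) 1 M' := isManifold_one
  have h1 := (mdifferentiableAt_extChartAt_symm hu).hasMFDerivAt
  have h2 := hf.hasMFDerivAt
  have h3 := (mdifferentiableAt_extChartAt (I := 𝓘(ℝ, F)) (x := b)
    (by simpa using hb)).hasMFDerivAt
  have h4 : HasFDerivAt (fun y => extChartAt 𝓘(ℝ, F) b (f ((extChartAt 𝓘(ℝ, E) a).symm y)))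
      ((chartDeriv b (f ((extChartAt 𝓘(ℝ, E) a).symm u))).comp
        ((modelDeriv f ((extChartAt 𝓘(ℝ, E) a).symm u)).comp (chartSymmDeriv a u))) u :=
    hasMFDerivAt_iff_hasFDerivAt.1 (h3.comp u (h2.comp u h1))
  exact h4.fderiv

theorem contDiffAt_coordinates {f : M → M'} {a : M} {b : M'} {u : E}
    (hu : u ∈ (extChartAt 𝓘(ℝ, E) a).target)
    (hf : ContMDiffAt 𝓘(ℝ, E) 𝓘(ℝ, F) ∞ f ((extChartAt 𝓘(ℝ, E) a).symm u))
    (hb : f ((extChartAt 𝓘(ℝ, E) a).symm u) ∈ (extChartAt 𝓘(ℝ, F) b).source) :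
    ContDiffAt ℝ ∞ (fun y => extChartAt 𝓘(ℝ, F) b (f ((extChartAt 𝓘(ℝ, E) a).symm y))) u := by
  have h3 : ContMDiffAt 𝓘(ℝ, F) 𝓘(ℝ, F) ∞ (extChartAt 𝓘(ℝ, F) b) _ :=
    contMDiffAt_extChartAt' (x := b) (by simpa using hb)
  exact (h3.comp u (hf.comp u (contMDiffAt_extChartAt_symm hu))).contDiffAt

/-- Coordinate expression, in the chart at `p`, of a vector field. -/
def fieldInChart (V : ∀ q : M, TangentSpace 𝓘(ℝ, E) q) (p : M) (u : E) : E :=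
  chartDeriv p ((extChartAt 𝓘(ℝ, E) p).symm u) (V ((extChartAt 𝓘(ℝ, E) p).symm u))

/-- The trivialization of the tangent bundle at `p` is the derivative of the chart at `p`, so
smoothness of the section is smoothness of its components. -/
theorem contDiffAt_fieldInChart {V : ∀ q : M, TangentSpace 𝓘(ℝ, E) q} {p : M} {u : E}
    (hu : u ∈ (extChartAt 𝓘(ℝ, E) p).target)
    (hV : ContMDiffAt 𝓘(ℝ, E) 𝓘(ℝ, E).tangent ∞
      (fun y => (⟨y, V y⟩ : TangentBundle 𝓘(ℝ, E) M)) ((extChartAt 𝓘(ℝ, E) p).symm u)) :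
    ContDiffAt ℝ ∞ (fieldInChart V p) u := by
  have : IsManifold 𝓘(ℝ, E) 1 M := isManifold_one
  have hs : (extChartAt 𝓘(ℝ, E) p).symm u ∈ (chartAt E p).source := by
    simpa using (extChartAt 𝓘(ℝ, E) p).map_target hu
  have h1 := ((trivializationAt E (TangentSpace 𝓘(ℝ, E)) p).contMDiffAt_section_iff
    (by simpa using hs)).1 hV
  have h2 := (h1.comp u (contMDiffAt_extChartAt_symm hu)).contDiffAt
  refine h2.congr_of_eventuallyEq ?_
  filter_upwards [(isOpen_extChartAt_target (I := 𝓘(ℝ, E)) p).mem_nhds hu] with y hy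
  have hys : (extChartAt 𝓘(ℝ, E) p).symm y ∈ (chartAt E p).source := by
    simpa using (extChartAt 𝓘(ℝ, E) p).map_target hy
  have := TangentBundle.continuousLinearMapAt_trivializationAt (I := 𝓘(ℝ, E)) hys
  have h3 := congrArg (fun A => A (V ((extChartAt 𝓘(ℝ, E) p).symm y))) this
  refine h3.symm.trans ?_
  rw [Bundle.Trivialization.continuousLinearMapAt_apply,
    Bundle.Trivialization.linearMapAt_apply, if_pos (by simpa using hys)]
  rfl

/-- The trivialization of the bundle of bilinear forms precomposes both slots with the inverse
tangent trivialization, which is the derivative of the inverse chart. -/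
theorem contDiffAt_bilinInChart
    {g : ∀ q : M, TangentSpace 𝓘(ℝ, E) q →L[ℝ] TangentSpace 𝓘(ℝ, E) q →L[ℝ] ℝ}
    (hg : IsSemiRiemannianMetric g) {p : M} {u : E}
    (hu : u ∈ (extChartAt 𝓘(ℝ, E) p).target) :
    ContDiffAt ℝ ∞ (bilinInChart g p) u := by
  have : IsManifold 𝓘(ℝ, E) 1 M := isManifold_one
  have hs : (extChartAt 𝓘(ℝ, E) p).symm u ∈ (chartAt E p).source := by
    simpa using (extChartAt 𝓘(ℝ, E) p).map_target hu
  have h1 := ((trivializationAt (E →L[ℝ] E →L[ℝ] ℝ)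
    (fun p : M => TangentSpace 𝓘(ℝ, E) p →L[ℝ] TangentSpace 𝓘(ℝ, E) p →L[ℝ] ℝ)
      p).contMDiffAt_section_iff
    (by simpa using hs)).1 (hg.contMDiff _)
  have h2 := (h1.comp u (contMDiffAt_extChartAt_symm hu)).contDiffAt
  refine h2.congr_of_eventuallyEq ?_
  filter_upwards [(isOpen_extChartAt_target (I := 𝓘(ℝ, E)) p).mem_nhds hu] with y hy
  have hys : (extChartAt 𝓘(ℝ, E) p).symm y ∈ (chartAt E p).source := by
    simpa using (extChartAt 𝓘(ℝ, E) p).map_target hy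
  have := TangentBundle.symmL_trivializationAt (I := 𝓘(ℝ, E)) hys
  have hsymm : ∀ v : E, (trivializationAt E (TangentSpace 𝓘(ℝ, E)) p).symm
      ((extChartAt 𝓘(ℝ, E) p).symm y) v = chartSymmDeriv p y v := by
    intro v
    rw [← Bundle.Trivialization.symmL_apply (R := ℝ) _ (by simpa using hys), this]
    simp only [modelWithCornersSelf_coe, Set.range_id, mfderivWithin_univ]
    rw [(extChartAt 𝓘(ℝ, E) p).right_inv hy]
    rfl
  ext v w
  simp only [Function.comp_apply, hom_trivializationAt_apply]
  refine Eq.trans ?_ (inCoordinates_apply_eq₂ (E₃ := Bundle.Trivial M ℝ) (by simpa using hys)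
    (by simpa using hys) (Set.mem_univ _)).symm
  have h3 := congrArg (fun A => A (g ((extChartAt 𝓘(ℝ, E) p).symm y)
    ((trivializationAt E (TangentSpace 𝓘(ℝ, E)) p).symm ((extChartAt 𝓘(ℝ, E) p).symm y) v)
    ((trivializationAt E (TangentSpace 𝓘(ℝ, E)) p).symm ((extChartAt 𝓘(ℝ, E) p).symm y) w)))
    (Bundle.Trivial.linearMapAt_trivialization ℝ M ℝ ((extChartAt 𝓘(ℝ, E) p).symm y))
  refine Eq.trans ?_ h3.symm
  rw [hsymm v, hsymm w]
  rfl

end Charts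

/-! ### Change of charts and independence of the chart. -/

section Transition

set_option maxSynthPendingDepth 3
set_option linter.unusedSectionVars false

variable {E : Type*} [NormedAddCommGroup E] [NormedSpace ℝ E]
  {F : Type*} [NormedAddCommGroup F] [NormedSpace ℝ F]
  {M : Type*} [TopologicalSpace M] [ChartedSpace E M] [IsManifold 𝓘(ℝ, E) ∞ M]

/-- A bilinear form field with values seen in the model space. -/
def modelBilin (g : ∀ q : M, TangentSpace 𝓘(ℝ, E) q →L[ℝ] TangentSpace 𝓘(ℝ, E) q →L[ℝ] ℝ) (q : M) :
    E →L[ℝ] E →L[ℝ] ℝ := g q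

/-- A 1-form with values seen in the model space. -/
def modelForm (θ : ∀ q : M, TangentSpace 𝓘(ℝ, E) q →L[ℝ] ℝ) (q : M) : E →L[ℝ] ℝ := θ q

/-- A vector field with values seen in the model space. -/
def modelField (V : ∀ q : M, TangentSpace 𝓘(ℝ, E) q) (q : M) : E := V q

/-- `TangentSpace` unfolds to the model space. Restating the definitions with model-space types lets
rewriting identify fibres over different base points. -/
theorem bilinInChart_eq
    (g : ∀ q : M, TangentSpace 𝓘(ℝ, E) q →L[ℝ] TangentSpace 𝓘(ℝ, E) q →L[ℝ] ℝ) (p : M) (u : E) :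
    bilinInChart g p u =
      pullBilin (modelBilin g ((extChartAt 𝓘(ℝ, E) p).symm u)) (chartSymmDeriv p u) := rfl

theorem formInChart_eq (θ : ∀ q : M, TangentSpace 𝓘(ℝ, E) q →L[ℝ] ℝ) (p : M) (u : E) :
    formInChart θ p u =
      (modelForm θ ((extChartAt 𝓘(ℝ, E) p).symm u)).comp (chartSymmDeriv p u) := rfl

theorem fieldInChart_eq (V : ∀ q : M, TangentSpace 𝓘(ℝ, E) q) (p : M) (u : E) :
    fieldInChart V p u = chartDeriv p ((extChartAt 𝓘(ℝ, E) p).symm u)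
      (modelField V ((extChartAt 𝓘(ℝ, E) p).symm u)) := rfl

theorem chartDeriv_chartSymmDeriv_apply {p : M} {u : E}
    (hu : u ∈ (extChartAt 𝓘(ℝ, E) p).target) (v : E) :
    chartDeriv p ((extChartAt 𝓘(ℝ, E) p).symm u) (chartSymmDeriv p u v) = v :=
  congrArg (fun A => A v) (chartDeriv_comp_chartSymmDeriv hu)

theorem chartSymmDeriv_chartDeriv_apply {p : M} {u : E}
    (hu : u ∈ (extChartAt 𝓘(ℝ, E) p).target) (v : E) :
    chartSymmDeriv p u (chartDeriv p ((extChartAt 𝓘(ℝ, E) p).symm u) v) = v :=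
  congrArg (fun A => A v) (chartSymmDeriv_comp_chartDeriv hu)

theorem chartSymmDeriv_chartDeriv_apply' {p q : M}
    (hq : q ∈ (extChartAt 𝓘(ℝ, E) p).source) (v : E) :
    chartSymmDeriv p (extChartAt 𝓘(ℝ, E) p q) (chartDeriv p q v) = v := by
  have := chartSymmDeriv_chartDeriv_apply ((extChartAt 𝓘(ℝ, E) p).map_source hq) v
  rwa [(extChartAt 𝓘(ℝ, E) p).left_inv hq] at this

theorem chartDeriv_chartSymmDeriv_apply' {p q : M}
    (hq : q ∈ (extChartAt 𝓘(ℝ, E) p).source) (v : E) :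
    chartDeriv p q (chartSymmDeriv p (extChartAt 𝓘(ℝ, E) p q) v) = v := by
  have := chartDeriv_chartSymmDeriv_apply ((extChartAt 𝓘(ℝ, E) p).map_source hq) v
  rwa [(extChartAt 𝓘(ℝ, E) p).left_inv hq] at this

theorem chartSymmDeriv_self (p : M) :
    chartSymmDeriv p (extChartAt 𝓘(ℝ, E) p p) = ContinuousLinearMap.id ℝ E := by
  ext v
  have := chartSymmDeriv_chartDeriv_apply' (mem_extChartAt_source (I := 𝓘(ℝ, E)) p) v
  rwa [chartDeriv_self] at this

theorem isInvertible_chartDeriv {p q : M} (hq : q ∈ (extChartAt 𝓘(ℝ, E) p).source) :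
    (chartDeriv (E := E) p q).IsInvertible :=
  .of_inverse (g := chartSymmDeriv p (extChartAt 𝓘(ℝ, E) p q))
    (ContinuousLinearMap.ext fun v => chartDeriv_chartSymmDeriv_apply' hq v)
    (ContinuousLinearMap.ext fun v => chartSymmDeriv_chartDeriv_apply' hq v)

/-- The transition map from the chart at `a` to the chart at `b`. -/
def transition (a b : M) (u : E) : E :=
  extChartAt 𝓘(ℝ, E) b ((extChartAt 𝓘(ℝ, E) a).symm u)

theorem fderiv_transition {a b : M} {u : E} (hu : u ∈ (extChartAt 𝓘(ℝ, E) a).target)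
    (hb : (extChartAt 𝓘(ℝ, E) a).symm u ∈ (extChartAt 𝓘(ℝ, E) b).source) :
    fderiv ℝ (transition a b) u =
      (chartDeriv b ((extChartAt 𝓘(ℝ, E) a).symm u)).comp (chartSymmDeriv a u) := by
  have h := fderiv_coordinates (f := id) hu mdifferentiableAt_id hb
  have h2 : modelDeriv (id : M → M) ((extChartAt 𝓘(ℝ, E) a).symm u) =
      ContinuousLinearMap.id ℝ E := mfderiv_id
  rw [h2] at h
  exact h

theorem contDiffAt_transition {a b : M} {u : E} (hu : u ∈ (extChartAt 𝓘(ℝ, E) a).target)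
    (hb : (extChartAt 𝓘(ℝ, E) a).symm u ∈ (extChartAt 𝓘(ℝ, E) b).source) :
    ContDiffAt ℝ ∞ (transition a b) u :=
  contDiffAt_coordinates (f := id) hu contMDiffAt_id hb

theorem eventually_mem_overlap {a b : M} {u : E} (hu : u ∈ (extChartAt 𝓘(ℝ, E) a).target)
    (hb : (extChartAt 𝓘(ℝ, E) a).symm u ∈ (extChartAt 𝓘(ℝ, E) b).source) :
    ∀ᶠ y in 𝓝 u, y ∈ (extChartAt 𝓘(ℝ, E) a).target ∧
      (extChartAt 𝓘(ℝ, E) a).symm y ∈ (extChartAt 𝓘(ℝ, E) b).source :=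
  ((isOpen_extChartAt_target (I := 𝓘(ℝ, E)) a).eventually_mem hu).and
    ((contMDiffAt_extChartAt_symm hu).continuousAt.eventually_mem
      ((isOpen_extChartAt_source (I := 𝓘(ℝ, E)) b).mem_nhds hb))

theorem isInvertible_fderiv_transition {a b : M} {u : E}
    (hu : u ∈ (extChartAt 𝓘(ℝ, E) a).target)
    (hb : (extChartAt 𝓘(ℝ, E) a).symm u ∈ (extChartAt 𝓘(ℝ, E) b).source) :
    (fderiv ℝ (transition a b) u).IsInvertible := by
  rw [fderiv_transition hu hb]
  refine (isInvertible_chartDeriv hb).comp ?_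
  exact .of_inverse (chartSymmDeriv_comp_chartDeriv hu) (chartDeriv_comp_chartSymmDeriv hu)

theorem bilinInChart_transition
    (g : ∀ q : M, TangentSpace 𝓘(ℝ, E) q →L[ℝ] TangentSpace 𝓘(ℝ, E) q →L[ℝ] ℝ) {a b : M} {u : E}
    (hu : u ∈ (extChartAt 𝓘(ℝ, E) a).target)
    (hb : (extChartAt 𝓘(ℝ, E) a).symm u ∈ (extChartAt 𝓘(ℝ, E) b).source) :
    bilinInChart g a u =
      pullBilin (bilinInChart g b (transition a b u)) (fderiv ℝ (transition a b) u) := by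
  rw [fderiv_transition hu hb]
  ext v w
  simp only [bilinInChart_eq, transition, pullBilin, ContinuousLinearMap.bilinearComp_apply,
    ContinuousLinearMap.comp_apply, chartSymmDeriv_chartDeriv_apply' hb,
    (extChartAt 𝓘(ℝ, E) b).left_inv hb]

theorem formInChart_transition (θ : ∀ q : M, TangentSpace 𝓘(ℝ, E) q →L[ℝ] ℝ) {a b : M} {u : E}
    (hu : u ∈ (extChartAt 𝓘(ℝ, E) a).target)
    (hb : (extChartAt 𝓘(ℝ, E) a).symm u ∈ (extChartAt 𝓘(ℝ, E) b).source) :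
    formInChart θ a u =
      (formInChart θ b (transition a b u)).comp (fderiv ℝ (transition a b) u) := by
  rw [fderiv_transition hu hb]
  ext v
  simp only [formInChart_eq, transition, ContinuousLinearMap.comp_apply,
    chartSymmDeriv_chartDeriv_apply' hb, (extChartAt 𝓘(ℝ, E) b).left_inv hb]

theorem fieldInChart_transition (V : ∀ q : M, TangentSpace 𝓘(ℝ, E) q) {a b : M} {u : E}
    (hu : u ∈ (extChartAt 𝓘(ℝ, E) a).target)
    (hb : (extChartAt 𝓘(ℝ, E) a).symm u ∈ (extChartAt 𝓘(ℝ, E) b).source) :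
    fieldInChart V b (transition a b u) = fderiv ℝ (transition a b) u (fieldInChart V a u) := by
  rw [fderiv_transition hu hb]
  simp only [fieldInChart_eq, transition, ContinuousLinearMap.comp_apply,
    chartSymmDeriv_chartDeriv_apply hu, (extChartAt 𝓘(ℝ, E) b).left_inv hb]

/-- A 1-form that is closed at `q` has symmetric derivative in any chart around `q`. -/
theorem fderiv_formInChart_symm {θ : ∀ q : M, TangentSpace 𝓘(ℝ, E) q →L[ℝ] ℝ} {p q : M}
    (hq : q ∈ (extChartAt 𝓘(ℝ, E) p).source)
    (hd : DifferentiableAt ℝ (formInChart θ p) (extChartAt 𝓘(ℝ, E) p q))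
    (hclosed : ∀ v w : TangentSpace 𝓘(ℝ, E) q, dForm θ q v w = 0) (v w : E) :
    fderiv ℝ (formInChart θ p) (extChartAt 𝓘(ℝ, E) p q) v w =
      fderiv ℝ (formInChart θ p) (extChartAt 𝓘(ℝ, E) p q) w v := by
  set u := extChartAt 𝓘(ℝ, E) q q with hu_def
  have hqu : (extChartAt 𝓘(ℝ, E) q).symm u = q := extChartAt_to_inv q
  have hu : u ∈ (extChartAt 𝓘(ℝ, E) q).target := mem_extChartAt_target q
  have hb : (extChartAt 𝓘(ℝ, E) q).symm u ∈ (extChartAt 𝓘(ℝ, E) p).source := by rwa [hqu]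
  have hφ := contDiffAt_transition hu hb
  have hφu : transition q p u = extChartAt 𝓘(ℝ, E) p q := by rw [transition, hqu]
  have hφ2 : DifferentiableAt ℝ (fderiv ℝ (transition q p)) u :=
    (hφ.fderiv_right (m := ∞) (by norm_cast)).differentiableAt (by simp)
  have hsymm : ∀ a b, fderiv ℝ (fderiv ℝ (transition q p)) u a b =
      fderiv ℝ (fderiv ℝ (transition q p)) u b a := fun a b =>
    (hφ.isSymmSndFDerivAt (by simp; norm_cast)) a b
  rw [← hφu] at hd ⊢
  have e : HasFDerivAt (fun y =>
      (formInChart θ p (transition q p y)).comp (fderiv ℝ (transition q p) y)) _ u :=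
    (hd.hasFDerivAt.comp u (hφ.differentiableAt (by simp)).hasFDerivAt).clm_comp hφ2.hasFDerivAt
  have e2 := e.congr_of_eventuallyEq ((eventually_mem_overlap hu hb).mono fun y hy =>
    formInChart_transition θ hy.1 hy.2)
  -- Vectors are pulled back to the chart at `q`, the one in which `dForm` at `q` is computed.
  obtain ⟨v, rfl⟩ := (isInvertible_fderiv_transition hu hb).surjective v
  obtain ⟨w, rfl⟩ := (isInvertible_fderiv_transition hu hb).surjective w
  have h := sub_eq_zero.1 (hclosed v w)
  rw [← hu_def, e2.fderiv] at h
  -- The second derivative of the transition map is symmetric and drops out.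
  simpa [hsymm v w] using h

/-- The chart at `p` has identity derivative at `p`, so no correction factor appears. -/
theorem mvfderiv_apply_of_coordinates {f : M → F} {p : M}
    (hf : DifferentiableAt ℝ (fun y => f ((extChartAt 𝓘(ℝ, E) p).symm y)) (extChartAt 𝓘(ℝ, E) p p))
    (v : E) : mvfderiv 𝓘(ℝ, E) f p v =
      fderiv ℝ (fun y => f ((extChartAt 𝓘(ℝ, E) p).symm y)) (extChartAt 𝓘(ℝ, E) p p) v := by
  have : IsManifold 𝓘(ℝ, E) 1 M := isManifold_one
  have h1 := (mdifferentiableAt_extChartAt (I := 𝓘(ℝ, E)) (mem_chart_source E p)).hasMFDerivAt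
  have h2 := hf.hasFDerivAt.hasMFDerivAt.comp p h1
  have h3 := h2.congr_of_eventuallyEq (f₁ := f) (by
    filter_upwards [extChartAt_source_mem_nhds (I := 𝓘(ℝ, E)) p] with q hq
    rw [Function.comp_apply, (extChartAt 𝓘(ℝ, E) p).left_inv hq])
  have h4 := congrArg (fun A => A v) h3.mfderiv
  refine h4.trans ?_
  exact congrArg _ (congrArg (fun A : E →L[ℝ] E => A v) (chartDeriv_self p))

variable [FiniteDimensional ℝ E]

theorem isInvertible_bilinInChart
    {g : ∀ q : M, TangentSpace 𝓘(ℝ, E) q →L[ℝ] TangentSpace 𝓘(ℝ, E) q →L[ℝ] ℝ}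
    (hg : IsSemiRiemannianMetric g) {p : M} {u : E}
    (hu : u ∈ (extChartAt 𝓘(ℝ, E) p).target) : (bilinInChart g p u).IsInvertible := by
  apply isInvertible_of_nondegenerate
  intro v hv
  have nd : ∀ q (y : E), (∀ w : E, modelBilin g q y w = 0) → y = 0 := hg.nondegenerate
  have h1 : chartSymmDeriv p u v = 0 := by
    refine nd ((extChartAt 𝓘(ℝ, E) p).symm u) _ fun w => ?_
    have := hv (chartDeriv (E := E) p ((extChartAt 𝓘(ℝ, E) p).symm u) w)
    rw [bilinInChart_eq, pullBilin, ContinuousLinearMap.bilinearComp_apply,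
      chartSymmDeriv_chartDeriv_apply hu] at this
    exact this
  rw [← chartDeriv_chartSymmDeriv_apply hu v, h1, map_zero]

/-- The covariant derivative of a vector field with values seen in the model space. -/
def modelCovDeriv (g : ∀ q : M, TangentSpace 𝓘(ℝ, E) q →L[ℝ] TangentSpace 𝓘(ℝ, E) q →L[ℝ] ℝ)
    (V : ∀ q : M, TangentSpace 𝓘(ℝ, E) q) (q : M) : E →L[ℝ] E := covDeriv g V q

theorem fieldInChart_self (V : ∀ q : M, TangentSpace 𝓘(ℝ, E) q) (q : M) :
    fieldInChart V q (extChartAt 𝓘(ℝ, E) q q) = modelField V q := by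
  rw [fieldInChart_eq, extChartAt_to_inv, chartDeriv_self]
  rfl

theorem modelCovDeriv_apply
    (g : ∀ q : M, TangentSpace 𝓘(ℝ, E) q →L[ℝ] TangentSpace 𝓘(ℝ, E) q →L[ℝ] ℝ)
    {V : ∀ q : M, TangentSpace 𝓘(ℝ, E) q} {q : M}
    (hd : DifferentiableAt ℝ (fieldInChart V q) (extChartAt 𝓘(ℝ, E) q q)) (v : E) :
    modelCovDeriv g V q v = fderiv ℝ (fieldInChart V q) (extChartAt 𝓘(ℝ, E) q q) v
      + christoffel (bilinInChart g q) (extChartAt 𝓘(ℝ, E) q q) v (modelField V q) := by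
  have h1 := mvfderiv_apply_of_coordinates
    (f := fun a : M => chartDeriv (E := E) q a (modelField V a)) hd v
  have h2 : modelDeriv (E := E) (F := E) (id : M → M) q v = v :=
    congrArg (fun A : E →L[ℝ] E => A v) (mfderiv_id (I := 𝓘(ℝ, E)) (x := q))
  have h3 : modelCovDeriv g V q v = mvfderiv 𝓘(ℝ, E)
      (fun a : M => chartDeriv (E := E) q a (modelField V a)) q v
        + christoffel (bilinInChart g q) (extChartAt 𝓘(ℝ, E) q q)
          (modelDeriv (E := E) (F := E) (id : M → M) q v) (modelField V q) := rfl
  rw [h3, h2, h1]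
  rfl

/-- The covariant derivative of a vector field, computed in any chart. -/
theorem chartDeriv_covDeriv
    {g : ∀ q : M, TangentSpace 𝓘(ℝ, E) q →L[ℝ] TangentSpace 𝓘(ℝ, E) q →L[ℝ] ℝ}
    (hg : IsSemiRiemannianMetric g) {V : ∀ q : M, TangentSpace 𝓘(ℝ, E) q} {p q : M}
    (hq : q ∈ (extChartAt 𝓘(ℝ, E) p).source)
    (hV : ContMDiffAt 𝓘(ℝ, E) 𝓘(ℝ, E).tangent ∞
      (fun y => (⟨y, V y⟩ : TangentBundle 𝓘(ℝ, E) M)) q) (v : E) :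
    chartDeriv p q (modelCovDeriv g V q v) =
      fderiv ℝ (fieldInChart V p) (extChartAt 𝓘(ℝ, E) p q) (chartDeriv (E := E) p q v)
        + christoffel (bilinInChart g p) (extChartAt 𝓘(ℝ, E) p q) (chartDeriv (E := E) p q v)
          (chartDeriv (E := E) p q (modelField V q)) := by
  set u := extChartAt 𝓘(ℝ, E) q q with hu_def
  have hqu : (extChartAt 𝓘(ℝ, E) q).symm u = q := extChartAt_to_inv q
  have hu : u ∈ (extChartAt 𝓘(ℝ, E) q).target := mem_extChartAt_target q
  have hb : (extChartAt 𝓘(ℝ, E) q).symm u ∈ (extChartAt 𝓘(ℝ, E) p).source := by rwa [hqu]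
  have hφ := contDiffAt_transition hu hb
  have hφu : transition q p u = extChartAt 𝓘(ℝ, E) p q := by rw [transition, hqu]
  have hφ2 : DifferentiableAt ℝ (fderiv ℝ (transition q p)) u :=
    (hφ.fderiv_right (m := ∞) (by norm_cast)).differentiableAt (by simp)
  have hp : transition q p u ∈ (extChartAt 𝓘(ℝ, E) p).target := by
    rw [hφu]; exact (extChartAt 𝓘(ℝ, E) p).map_source hq
  have hpq : (extChartAt 𝓘(ℝ, E) p).symm (transition q p u) = q := by
    rw [hφu]; exact (extChartAt 𝓘(ℝ, E) p).left_inv hq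
  have hd : DifferentiableAt ℝ (fieldInChart V q) u :=
    (contDiffAt_fieldInChart hu (by rwa [hqu])).differentiableAt (by simp)
  have hdp : DifferentiableAt ℝ (fieldInChart V p) (transition q p u) :=
    (contDiffAt_fieldInChart hp (by rwa [hpq])).differentiableAt (by simp)
  have hVq : fieldInChart V q u = modelField V q := fieldInChart_self V q
  have h1 := modelCovDeriv_apply g hd v
  have hD : fderiv ℝ (transition q p) u = chartDeriv (E := E) p q := by
    rw [fderiv_transition hu hb, hu_def, chartSymmDeriv_self, ContinuousLinearMap.comp_id, hqu]
  have hbil : bilinInChart g q =ᶠ[𝓝 u] fun y =>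
      pullBilin (bilinInChart g p (transition q p y)) (fderiv ℝ (transition q p) y) :=
    (eventually_mem_overlap hu hb).mono fun y hy => bilinInChart_transition g hy.1 hy.2
  have hchr : christoffel (bilinInChart g q) u = christoffel (fun y =>
      pullBilin (bilinInChart g p (transition q p y)) (fderiv ℝ (transition q p) y)) u := by
    rw [christoffel, christoffel, christoffelFirst, christoffelFirst, hbil.fderiv_eq, hbil.eq_of_nhds]
  have hinv : (bilinInChart g p (transition q p u)).IsInvertible := isInvertible_bilinInChart hg hp
  have hs : ∀ᶠ y in 𝓝 (transition q p u), ∀ v w, bilinInChart g p y v w = bilinInChart g p y w v :=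
    Eventually.of_forall fun y v w => hg.symm _ _ _
  -- The second derivative of the transition in this law cancels the one produced below by
  -- differentiating the transformed field.
  have h3 := christoffel_pullback hinv (contDiffAt_bilinInChart hg hp) hs hφ
    (isInvertible_fderiv_transition hu hb) v (fieldInChart V q u)
  have e1 : HasFDerivAt (fun y => fieldInChart V p (transition q p y)) _ u :=
    hdp.hasFDerivAt.comp u (hφ.differentiableAt (by simp)).hasFDerivAt
  have e2 := (hφ2.hasFDerivAt.clm_apply hd.hasFDerivAt).congr_of_eventuallyEq
    ((eventually_mem_overlap hu hb).mono fun y hy => fieldInChart_transition V hy.1 hy.2)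
  have h4 := congrArg (fun A => A v) (e1.unique e2)
  have h5 := fieldInChart_transition V hu hb
  simp only [ContinuousLinearMap.comp_apply, add_apply, ContinuousLinearMap.flip_apply] at h4
  rw [h1, ← hφu, ← hD, map_add, hchr, ← hVq, h3, h4]
  abel

end Transition

/-! ### Immersions, transversality and existence of the rigged field. -/

section Hypersurface

set_option maxSynthPendingDepth 3
set_option linter.unusedSectionVars false

variable {E : Type*} [NormedAddCommGroup E] [NormedSpace ℝ E]
  {F : Type*} [NormedAddCommGroup F] [NormedSpace ℝ F]
  {M : Type*} [TopologicalSpace M] [ChartedSpace E M] [IsManifold 𝓘(ℝ, E) ∞ M]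
  {M' : Type*} [TopologicalSpace M'] [ChartedSpace F M'] [IsManifold 𝓘(ℝ, F) ∞ M']

/-- The derivative of an immersion is injective. -/
theorem mfderiv_injective_of_isImmersionAt {x : M → M'} {q : M}
    (h : Manifold.IsImmersionAt 𝓘(ℝ, E) 𝓘(ℝ, F) ∞ x q) :
    Function.Injective (modelDeriv (E := E) (F := F) x q) := by
  have hmE : IsManifold 𝓘(ℝ, E) 1 M := isManifold_one
  have hmF : IsManifold 𝓘(ℝ, F) 1 M' := isManifold_one
  set φ := h.domChart with hφ_def
  set ψ := h.codChart with hψ_def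
  have hq : q ∈ φ.source := h.mem_domChart_source
  have hxq : x q ∈ ψ.source := h.mem_codChart_source
  have hφ : φ.MDifferentiable 𝓘(ℝ, E) 𝓘(ℝ, E) :=
    ⟨(contMDiffOn_of_mem_maximalAtlas h.domChart_mem_maximalAtlas).mdifferentiableOn (by simp),
      (contMDiffOn_symm_of_mem_maximalAtlas h.domChart_mem_maximalAtlas).mdifferentiableOn
        (by simp)⟩
  have hψ : MDifferentiableAt 𝓘(ℝ, F) 𝓘(ℝ, F) ψ (x q) :=
    ((contMDiffOn_of_mem_maximalAtlas h.codChart_mem_maximalAtlas).mdifferentiableOn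
      (by simp)).mdifferentiableAt (ψ.open_source.mem_nhds hxq)
  have hx : MDifferentiableAt 𝓘(ℝ, E) 𝓘(ℝ, F) x q := h.contMDiffAt.mdifferentiableAt (by simp)
  -- In adapted charts the immersion is v ↦ (v, 0), whose injectivity passes to the derivative.
  have hev : (fun a => ψ (x a)) =ᶠ[𝓝 q] fun a => h.equiv (φ a, 0) := by
    filter_upwards [φ.open_source.mem_nhds hq] with a ha
    have hmem : φ a ∈ (h.domChart.extend 𝓘(ℝ, E)).target := by simpa using φ.map_source ha
    have := h.writtenInCharts hmem
    simpa [← hφ_def, ← hψ_def, φ.left_inv ha] using this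
  have h1 := hψ.hasMFDerivAt.comp q hx.hasMFDerivAt
  have h2 := (hφ.mdifferentiableAt hq).hasMFDerivAt
  set L : E →L[ℝ] F := (h.equiv : (E × h.complement) →L[ℝ] F).comp
    (ContinuousLinearMap.inl ℝ E h.complement)
  have h3 : HasMFDerivAt 𝓘(ℝ, E) 𝓘(ℝ, F) (fun a => h.equiv (φ a, 0)) q _ :=
    L.hasMFDerivAt.comp q h2
  have h4 := hasMFDerivAt_unique (h1.congr_of_eventuallyEq hev.symm) h3
  intro v w hvw
  apply hφ.mfderiv_injective hq
  have h5 := congrArg (fun A : E →L[ℝ] F => A v) h4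
  have h6 := congrArg (fun A : E →L[ℝ] F => A w) h4
  have h7 : L (mfderiv 𝓘(ℝ, E) 𝓘(ℝ, E) φ q v) = L (mfderiv 𝓘(ℝ, E) 𝓘(ℝ, E) φ q w) :=
    h5.symm.trans ((congrArg (mfderiv 𝓘(ℝ, F) 𝓘(ℝ, F) ψ (x q)) hvw).trans h6)
  have h8 := h.equiv.injective h7
  exact (Prod.mk.inj h8).1

variable [FiniteDimensional ℝ E] [FiniteDimensional ℝ F]
  {g : ∀ y : M', TangentSpace 𝓘(ℝ, F) y →L[ℝ] TangentSpace 𝓘(ℝ, F) y →L[ℝ] ℝ}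
  {x : M → M'} {N : ∀ y : M', TangentSpace 𝓘(ℝ, F) y} {U : Set M'}

/-- The splitting map `(v, b) ↦ dx(v) + b N`, between model spaces. -/
def modelSplit (x : M → M') (N : ∀ y : M', TangentSpace 𝓘(ℝ, F) y) (q : M) : E × ℝ →L[ℝ] F :=
  (modelDeriv x q).coprod ((ContinuousLinearMap.id ℝ ℝ).smulRight (modelField N (x q)))

/-- Transversality of N and injectivity of dx make the map injective; codimension one matches the
dimensions. -/
theorem isInvertible_modelSplit (hx : IsNullHypersurface (E := E) g x)
    (hN : IsNullRigging (E := E) g x N U) (q : M) :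
    (modelSplit (E := E) x N q).IsInvertible := by
  apply isInvertible_of_injective
  · rw [injective_iff_map_eq_zero]
    rintro ⟨v, b⟩ h
    have h1 : modelDeriv (E := E) (F := F) x q v + b • modelField N (x q) = 0 := by
      simpa [modelSplit] using h
    have ht : ∀ v : E, modelDeriv (E := E) (F := F) x q v ≠ modelField N (x q) :=
      hN.transverse q
    have hb : b = 0 := by
      by_contra hb
      apply ht (-(b⁻¹ • v))
      rw [map_neg, map_smul, eq_neg_of_add_eq_zero_left h1, smul_neg, neg_neg, smul_smul,
        inv_mul_cancel₀ hb, one_smul]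
    have hv : v = 0 := by
      apply mfderiv_injective_of_isImmersionAt (hx.embedding.isImmersion.isImmersionAt q)
      rw [map_zero]
      simpa [hb] using h1
    rw [hb, hv]; rfl
  · rw [hx.codim]; simp

/-- The `epsilon` choice needs existence. A nonzero null direction u has g(u,N) ≠ 0, since otherwise
it would be orthogonal to TM ⊕ ℝN; rescale it. -/
theorem riggedField_spec (hg : IsSemiRiemannianMetric g) (hx : IsNullHypersurface (E := E) g x)
    (hN : IsNullRigging (E := E) g x N U) (q : M) :
    (∀ v : E, modelBilin g (x q) (modelDeriv (E := E) x q (modelField (riggedField g x N) q))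
      (modelDeriv x q v) = 0) ∧
    modelBilin g (x q) (modelDeriv (E := E) x q (modelField (riggedField g x N) q))
      (modelField N (x q)) = 1 := by
  obtain ⟨u, hu0, hu'⟩ : ∃ u : E, u ≠ 0 ∧
      ∀ v : E, modelBilin g (x q) (modelDeriv (E := E) x q u) (modelDeriv x q v) = 0 := hx.null q
  have nd : ∀ y : F, (∀ w : F, modelBilin g (x q) y w = 0) → y = 0 := hg.nondegenerate (x q)
  set c := modelBilin g (x q) (modelDeriv (E := E) x q u) (modelField N (x q)) with hc_def
  have hc : c ≠ 0 := by
    intro hc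
    apply hu0
    apply mfderiv_injective_of_isImmersionAt (hx.embedding.isImmersion.isImmersionAt q)
    refine (nd _ fun w => ?_).trans (map_zero (modelDeriv (E := E) (F := F) x q)).symm
    obtain ⟨⟨v, b⟩, rfl⟩ := (isInvertible_modelSplit hx hN q).surjective w
    simp only [modelSplit, ContinuousLinearMap.coprod_apply, map_add, hu', zero_add]
    simp [← hc_def, hc]
  have hex : ∃ u : TangentSpace 𝓘(ℝ, E) q, (∀ v, pullbackMetric g x q u v = 0) ∧
      g (x q) (dMap x q u) (N (x q)) = 1 := by
    refine ⟨(c⁻¹ • u : E), ?_⟩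
    have h1 : (∀ v : E, modelBilin g (x q) (modelDeriv (E := E) x q (c⁻¹ • u))
        (modelDeriv x q v) = 0) ∧
        modelBilin g (x q) (modelDeriv (E := E) x q (c⁻¹ • u)) (modelField N (x q)) = 1 := by
      refine ⟨fun v => ?_, ?_⟩
      · rw [map_smul, map_smul, smul_apply, hu', smul_zero]
      · rw [map_smul, map_smul, smul_apply, ← hc_def, smul_eq_mul, inv_mul_cancel₀ hc]
    exact h1
  exact Classical.epsilon_spec hex

end Hypersurface

/-! ### The hypersurface read in the charts at `p` and `x p`. -/

section HypersurfaceCharts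

set_option maxSynthPendingDepth 3
set_option linter.unusedSectionVars false

variable {E : Type*} [NormedAddCommGroup E] [NormedSpace ℝ E]
  {F : Type*} [NormedAddCommGroup F] [NormedSpace ℝ F]
  {M : Type*} [TopologicalSpace M] [ChartedSpace E M] [IsManifold 𝓘(ℝ, E) ∞ M]
  {M' : Type*} [TopologicalSpace M'] [ChartedSpace F M'] [IsManifold 𝓘(ℝ, F) ∞ M']

/-- A map in the charts at `p` and `x p`. -/
def mapInChart (x : M → M') (p : M) (u : E) : F :=
  extChartAt 𝓘(ℝ, F) (x p) (x ((extChartAt 𝓘(ℝ, E) p).symm u))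

/-- The points of the chart at `p` that `x` maps to the domain of the chart at `x p`. -/
def mapChartDomain (E : Type*) {F : Type*} [NormedAddCommGroup E] [NormedSpace ℝ E]
    [NormedAddCommGroup F] [NormedSpace ℝ F]
    {M : Type*} [TopologicalSpace M] [ChartedSpace E M]
    {M' : Type*} [TopologicalSpace M'] [ChartedSpace F M'] (x : M → M') (p : M) : Set E :=
  {u | u ∈ (extChartAt 𝓘(ℝ, E) p).target ∧
    x ((extChartAt 𝓘(ℝ, E) p).symm u) ∈ (extChartAt 𝓘(ℝ, F) (x p)).source}

variable {g : ∀ y : M', TangentSpace 𝓘(ℝ, F) y →L[ℝ] TangentSpace 𝓘(ℝ, F) y →L[ℝ] ℝ}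
  {x : M → M'} {N : ∀ y : M', TangentSpace 𝓘(ℝ, F) y} {U : Set M'} {p : M} {u : E}

theorem self_mem_mapChartDomain (x : M → M') (p : M) :
    extChartAt 𝓘(ℝ, E) p p ∈ mapChartDomain E (F := F) x p :=
  ⟨mem_extChartAt_target p, by rw [extChartAt_to_inv]; exact mem_extChartAt_source _⟩

theorem mapChartDomain_mem_nhds (hx : Continuous x) (hu : u ∈ mapChartDomain E (F := F) x p) :
    mapChartDomain E (F := F) x p ∈ 𝓝 u :=
  inter_mem ((isOpen_extChartAt_target (I := 𝓘(ℝ, E)) p).mem_nhds hu.1)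
    ((hx.continuousAt.comp (contMDiffAt_extChartAt_symm hu.1).continuousAt).eventually_mem
      ((isOpen_extChartAt_source (I := 𝓘(ℝ, F)) (x p)).mem_nhds hu.2))

theorem contDiffAt_mapInChart (hx : ContMDiff 𝓘(ℝ, E) 𝓘(ℝ, F) ∞ x)
    (hu : u ∈ mapChartDomain E (F := F) x p) : ContDiffAt ℝ ∞ (mapInChart (F := F) x p) u :=
  contDiffAt_coordinates hu.1 (hx _) hu.2

theorem fderiv_mapInChart_chartDeriv (hx : ContMDiff 𝓘(ℝ, E) 𝓘(ℝ, F) ∞ x)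
    (hu : u ∈ mapChartDomain E (F := F) x p) (v : E) :
    fderiv ℝ (mapInChart (F := F) x p) u v =
      chartDeriv (E := F) (x p) (x ((extChartAt 𝓘(ℝ, E) p).symm u))
        (modelDeriv x ((extChartAt 𝓘(ℝ, E) p).symm u) (chartSymmDeriv (E := E) p u v)) :=
  congrArg (fun A : E →L[ℝ] F => A v)
    (fderiv_coordinates hu.1 ((hx _).mdifferentiableAt (by simp)) hu.2)

theorem fderiv_mapInChart_fieldInChart (hx : ContMDiff 𝓘(ℝ, E) 𝓘(ℝ, F) ∞ x)
    (hu : u ∈ mapChartDomain E (F := F) x p) (V : ∀ q : M, TangentSpace 𝓘(ℝ, E) q) :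
    fderiv ℝ (mapInChart (F := F) x p) u (fieldInChart V p u) =
      chartDeriv (E := F) (x p) (x ((extChartAt 𝓘(ℝ, E) p).symm u))
        (modelDeriv x ((extChartAt 𝓘(ℝ, E) p).symm u)
          (modelField V ((extChartAt 𝓘(ℝ, E) p).symm u))) := by
  rw [fderiv_mapInChart_chartDeriv hx hu, fieldInChart_eq, chartSymmDeriv_chartDeriv_apply hu.1]

theorem symm_mapInChart (hu : u ∈ mapChartDomain E (F := F) x p) :
    (extChartAt 𝓘(ℝ, F) (x p)).symm (mapInChart (F := F) x p u) =
      x ((extChartAt 𝓘(ℝ, E) p).symm u) :=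
  (extChartAt 𝓘(ℝ, F) (x p)).left_inv hu.2

theorem mapInChart_mem_target (hu : u ∈ mapChartDomain E (F := F) x p) :
    mapInChart (F := F) x p u ∈ (extChartAt 𝓘(ℝ, F) (x p)).target :=
  (extChartAt 𝓘(ℝ, F) (x p)).map_source hu.2

theorem bilinInChart_mapInChart_apply (hu : u ∈ mapChartDomain E (F := F) x p) (s t : F) :
    bilinInChart g (x p) (mapInChart x p u)
      (chartDeriv (x p) (x ((extChartAt 𝓘(ℝ, E) p).symm u)) s)
      (chartDeriv (x p) (x ((extChartAt 𝓘(ℝ, E) p).symm u)) t) =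
    modelBilin g (x ((extChartAt 𝓘(ℝ, E) p).symm u)) s t := by
  rw [bilinInChart_eq, pullBilin, ContinuousLinearMap.bilinearComp_apply, symm_mapInChart hu,
    mapInChart, chartSymmDeriv_chartDeriv_apply' hu.2, chartSymmDeriv_chartDeriv_apply' hu.2]

theorem fieldInChart_mapInChart (hu : u ∈ mapChartDomain E (F := F) x p) :
    fieldInChart N (x p) (mapInChart x p u) =
      chartDeriv (x p) (x ((extChartAt 𝓘(ℝ, E) p).symm u))
        (modelField N (x ((extChartAt 𝓘(ℝ, E) p).symm u))) := by
  rw [fieldInChart_eq, symm_mapInChart hu]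

theorem localEta_eq_formInChart (hx : ContMDiff 𝓘(ℝ, E) 𝓘(ℝ, F) ∞ x)
    (hu : u ∈ mapChartDomain E (F := F) x p) :
    localEta (bilinInChart g (x p)) (mapInChart x p) (fieldInChart N (x p)) u =
      formInChart (eta (E := E) g x N) p u := by
  ext v
  rw [localEta, ContinuousLinearMap.comp_apply, fderiv_mapInChart_chartDeriv hx hu,
    fieldInChart_mapInChart hu, bilinInChart_mapInChart_apply hu]
  rfl

theorem localAssociated_eq_bilinInChart (hx : ContMDiff 𝓘(ℝ, E) 𝓘(ℝ, F) ∞ x) (α : M → ℝ)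
    (hu : u ∈ mapChartDomain E (F := F) x p) :
    localAssociated (bilinInChart g (x p)) (mapInChart x p) (fieldInChart N (x p))
      (fun y => α ((extChartAt 𝓘(ℝ, E) p).symm y)) u =
      bilinInChart (associatedMetric (E := E) g x N α) p u := by
  ext v w
  rw [localAssociated, localEta_eq_formInChart hx hu, add_apply, add_apply, pullBilin,
    ContinuousLinearMap.bilinearComp_apply,
    fderiv_mapInChart_chartDeriv hx hu, fderiv_mapInChart_chartDeriv hx hu,
    bilinInChart_mapInChart_apply hu]
  rfl

theorem contMDiffAt_rigging (hN : IsNullRigging (E := E) g x N U) (q : M) :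
    ContMDiffAt 𝓘(ℝ, F) 𝓘(ℝ, F).tangent ∞
      (fun y => (⟨y, N y⟩ : TangentBundle 𝓘(ℝ, F) M')) (x q) :=
  hN.contMDiffOn.contMDiffAt (hN.isOpen.mem_nhds (hN.subset ⟨q, rfl⟩))

theorem contDiffAt_rigging (hN : IsNullRigging (E := E) g x N U)
    (hu : u ∈ mapChartDomain E (F := F) x p) :
    ContDiffAt ℝ ∞ (fieldInChart N (x p)) (mapInChart x p u) :=
  contDiffAt_fieldInChart (mapInChart_mem_target hu)
    (by rw [symm_mapInChart hu]; exact contMDiffAt_rigging hN _)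

variable [FiniteDimensional ℝ E] [FiniteDimensional ℝ F]

theorem localSplit_eq (hx : ContMDiff 𝓘(ℝ, E) 𝓘(ℝ, F) ∞ x)
    (hu : u ∈ mapChartDomain E (F := F) x p) (v : E) (b : ℝ) :
    localSplit (mapInChart x p) (fieldInChart N (x p)) u (v, b) =
      chartDeriv (x p) (x ((extChartAt 𝓘(ℝ, E) p).symm u))
        (modelSplit (E := E) x N ((extChartAt 𝓘(ℝ, E) p).symm u) (chartSymmDeriv p u v, b)) := by
  rw [localSplit_apply, fderiv_mapInChart_chartDeriv hx hu, fieldInChart_mapInChart hu,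
    ← map_smul, ← map_add]
  simp [modelSplit]

theorem injective_chartSymmDeriv (hu : u ∈ (extChartAt 𝓘(ℝ, E) p).target) :
    Function.Injective (chartSymmDeriv (E := E) p u) :=
  Function.LeftInverse.injective (fun v => chartDeriv_chartSymmDeriv_apply hu v)

/-- A null hypersurface with a null rigging of closed normalization, read in charts. -/
theorem isLocalNullRigging_inChart (hg : IsSemiRiemannianMetric g)
    (hx : IsNullHypersurface (E := E) g x) (hN : IsNullRigging (E := E) g x N U)
    (hclosed : ∀ (p : M) (v w : TangentSpace 𝓘(ℝ, E) p), dForm (eta g x N) p v w = 0)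
    (hu : u ∈ mapChartDomain E (F := F) x p) :
    IsLocalNullRigging (bilinInChart g (x p)) (mapInChart x p) (fieldInChart N (x p))
      (fieldInChart (riggedField (E := E) g x N) p) u := by
  have hx' : ContMDiff 𝓘(ℝ, E) 𝓘(ℝ, F) ∞ x := hx.embedding.contMDiff
  have ht := mapInChart_mem_target hu
  have hcX := contDiffAt_mapInChart hx' hu
  have hcG := contDiffAt_bilinInChart hg ht
  have hcN := contDiffAt_rigging hN hu
  have hspec := riggedField_spec hg hx hN ((extChartAt 𝓘(ℝ, E) p).symm u)
  refine ⟨hcX, hcG, hcN, Eventually.of_forall fun y v w => hg.symm _ _ _,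
    isInvertible_bilinInChart hg ht, ?_, fun v => ?_, ?_, ?_, fun v w => ?_⟩
  · apply isInvertible_of_injective
    · rintro ⟨v, b⟩ ⟨v', b'⟩ h
      rw [localSplit_eq hx' hu, localSplit_eq hx' hu] at h
      have h2 := (isInvertible_modelSplit hx hN _).injective
        ((isInvertible_chartDeriv hu.2).injective h)
      obtain ⟨h3, h4⟩ := Prod.mk.inj h2
      rw [injective_chartSymmDeriv hu.1 h3, h4]
    · rw [hx.codim]; simp
  · rw [fderiv_mapInChart_fieldInChart hx' hu, fderiv_mapInChart_chartDeriv hx' hu,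
      bilinInChart_mapInChart_apply hu]
    exact hspec.1 _
  · rw [fderiv_mapInChart_fieldInChart hx' hu, fieldInChart_mapInChart hu,
      bilinInChart_mapInChart_apply hu]
    exact hspec.2
  · rw [fieldInChart_mapInChart hu, bilinInChart_mapInChart_apply hu]
    exact hN.null _
  -- Closedness is given at each point in that point's own chart; here it is needed throughout the
  -- fixed chart at `p`.
  · have hev : localEta (bilinInChart g (x p)) (mapInChart x p) (fieldInChart N (x p)) =ᶠ[𝓝 u]
        formInChart (eta (E := E) g x N) p := by
      filter_upwards [mapChartDomain_mem_nhds hx'.continuous hu] with y hy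
      exact localEta_eq_formInChart hx' hy
    have hd : DifferentiableAt ℝ (formInChart (eta (E := E) g x N) p) u := by
      refine DifferentiableAt.congr_of_eventuallyEq ?_ hev.symm
      exact ((((hcG.comp u hcX).clm_apply (hcN.comp u hcX)).clm_comp
        (hcX.fderiv_right (m := ∞) (by norm_cast))).differentiableAt (by simp))
    rw [hev.fderiv_eq]
    have hq : (extChartAt 𝓘(ℝ, E) p).symm u ∈ (extChartAt 𝓘(ℝ, E) p).source :=
      (extChartAt 𝓘(ℝ, E) p).map_target hu.1
    have huu : extChartAt 𝓘(ℝ, E) p ((extChartAt 𝓘(ℝ, E) p).symm u) = u :=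
      (extChartAt 𝓘(ℝ, E) p).right_inv hu.1
    have := fderiv_formInChart_symm (θ := eta (E := E) g x N) hq (by rwa [huu])
      (hclosed _) v w
    rwa [huu] at this

end HypersurfaceCharts

/-! ### Identification of the geometric objects with their coordinate versions. -/

section CentredCharts

set_option maxSynthPendingDepth 3
set_option linter.unusedSectionVars false

variable {E : Type*} [NormedAddCommGroup E] [NormedSpace ℝ E] [FiniteDimensional ℝ E]
  {F : Type*} [NormedAddCommGroup F] [NormedSpace ℝ F] [FiniteDimensional ℝ F]
  {M : Type*} [TopologicalSpace M] [ChartedSpace E M] [IsManifold 𝓘(ℝ, E) ∞ M]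
  {M' : Type*} [TopologicalSpace M'] [ChartedSpace F M'] [IsManifold 𝓘(ℝ, F) ∞ M']
  {g : ∀ y : M', TangentSpace 𝓘(ℝ, F) y →L[ℝ] TangentSpace 𝓘(ℝ, F) y →L[ℝ] ℝ}
  {x : M → M'} {N : ∀ y : M', TangentSpace 𝓘(ℝ, F) y} {U : Set M'} {p : M} {u : E}

/-- `covDeriv` at each point uses that point's chart, while the left side uses the chart at `x p`
throughout; `chartDeriv_covDeriv` reconciles the two. -/
theorem localDerivRigging_eq (hg : IsSemiRiemannianMetric g)
    (hx : ContMDiff 𝓘(ℝ, E) 𝓘(ℝ, F) ∞ x) (hN : IsNullRigging (E := E) g x N U)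
    (hu : u ∈ mapChartDomain E (F := F) x p) (v : E) :
    localDerivRigging (bilinInChart g (x p)) (mapInChart x p) (fieldInChart N (x p)) u v =
      chartDeriv (x p) (x ((extChartAt 𝓘(ℝ, E) p).symm u))
        (modelCovDeriv g N (x ((extChartAt 𝓘(ℝ, E) p).symm u))
          (modelDeriv x ((extChartAt 𝓘(ℝ, E) p).symm u) (chartSymmDeriv (E := E) p u v))) := by
  rw [localDerivRigging_apply, fderiv_mapInChart_chartDeriv hx hu, fieldInChart_mapInChart hu]
  exact (chartDeriv_covDeriv hg hu.2 (contMDiffAt_rigging hN _) _).symm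

/-- Needed on the whole chart domain, not only at the centre, because dτ differentiates τ. -/
theorem localRotation_eq_formInChart (hg : IsSemiRiemannianMetric g)
    (hx : ContMDiff 𝓘(ℝ, E) 𝓘(ℝ, F) ∞ x) (hN : IsNullRigging (E := E) g x N U)
    (hu : u ∈ mapChartDomain E (F := F) x p) :
    localRotation (bilinInChart g (x p)) (mapInChart x p) (fieldInChart N (x p))
      (fieldInChart (riggedField (E := E) g x N) p) u =
      formInChart (rotationForm (E := E) g x N) p u := by
  ext v
  rw [localRotation, ContinuousLinearMap.comp_apply, localDerivRigging_eq hg hx hN hu,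
    fderiv_mapInChart_fieldInChart hx hu, bilinInChart_mapInChart_apply hu]
  rfl

theorem fderiv_mapInChart_self (hx : ContMDiff 𝓘(ℝ, E) 𝓘(ℝ, F) ∞ x) (p : M) :
    fderiv ℝ (mapInChart (F := F) x p) (extChartAt 𝓘(ℝ, E) p p) = modelDeriv (E := E) x p := by
  ext v
  rw [fderiv_mapInChart_chartDeriv hx (self_mem_mapChartDomain x p), extChartAt_to_inv,
    chartDeriv_self, chartSymmDeriv_self]
  rfl

theorem mapInChart_self (x : M → M') (p : M) :
    mapInChart (E := E) (F := F) x p (extChartAt 𝓘(ℝ, E) p p) = extChartAt 𝓘(ℝ, F) (x p) (x p) := by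
  rw [mapInChart, extChartAt_to_inv]

theorem bilinInChart_self
    (g : ∀ q : M, TangentSpace 𝓘(ℝ, E) q →L[ℝ] TangentSpace 𝓘(ℝ, E) q →L[ℝ] ℝ) (q : M) :
    bilinInChart g q (extChartAt 𝓘(ℝ, E) q q) = modelBilin g q := by
  rw [bilinInChart_eq, chartSymmDeriv_self, extChartAt_to_inv]
  rfl

theorem localProj_self (hx : ContMDiff 𝓘(ℝ, E) 𝓘(ℝ, F) ∞ x) (p : M) :
    localProj (mapInChart (E := E) x p) (fieldInChart N (x p)) (extChartAt 𝓘(ℝ, E) p p) =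
      (tangentialPart (E := E) x N p : F →L[ℝ] E) := by
  have : localSplit (mapInChart (E := E) x p) (fieldInChart N (x p)) (extChartAt 𝓘(ℝ, E) p p) =
      modelSplit x N p := by
    rw [localSplit, modelSplit, fderiv_mapInChart_self hx, mapInChart_self, fieldInChart_self]
  rw [localProj, this]
  rfl

theorem localDerivRigging_self (hg : IsSemiRiemannianMetric g)
    (hx : ContMDiff 𝓘(ℝ, E) 𝓘(ℝ, F) ∞ x) (hN : IsNullRigging (E := E) g x N U) (p : M) :
    localDerivRigging (bilinInChart g (x p)) (mapInChart (E := E) x p) (fieldInChart N (x p))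
      (extChartAt 𝓘(ℝ, E) p p) = (derivRigging (E := E) g x N p : E →L[ℝ] F) := by
  ext v
  rw [localDerivRigging_eq hg hx hN (self_mem_mapChartDomain x p), extChartAt_to_inv,
    chartDeriv_self, chartSymmDeriv_self]
  rfl

theorem localShape_self (hg : IsSemiRiemannianMetric g)
    (hx : ContMDiff 𝓘(ℝ, E) 𝓘(ℝ, F) ∞ x) (hN : IsNullRigging (E := E) g x N U) (p : M) :
    localShape (bilinInChart g (x p)) (mapInChart (E := E) x p) (fieldInChart N (x p))
      (extChartAt 𝓘(ℝ, E) p p) = (shapeN (E := E) g x N p : E →L[ℝ] E) := by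
  rw [localShape, localProj_self hx, localDerivRigging_self hg hx hN]
  rfl

theorem modelForm_rotationForm (hg : IsSemiRiemannianMetric g)
    (hx : ContMDiff 𝓘(ℝ, E) 𝓘(ℝ, F) ∞ x) (hN : IsNullRigging (E := E) g x N U) (p : M) :
    localRotation (bilinInChart g (x p)) (mapInChart x p) (fieldInChart N (x p))
      (fieldInChart (riggedField (E := E) g x N) p) (extChartAt 𝓘(ℝ, E) p p) =
      modelForm (rotationForm (E := E) g x N) p := by
  rw [localRotation_eq_formInChart hg hx hN (self_mem_mapChartDomain x p), formInChart_eq,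
    chartSymmDeriv_self, extChartAt_to_inv]
  rfl

theorem localEta_self (hx : ContMDiff 𝓘(ℝ, E) 𝓘(ℝ, F) ∞ x) (p : M) :
    localEta (bilinInChart g (x p)) (mapInChart x p) (fieldInChart N (x p))
      (extChartAt 𝓘(ℝ, E) p p) = modelForm (eta (E := E) g x N) p := by
  rw [localEta_eq_formInChart hx (self_mem_mapChartDomain x p), formInChart_eq,
    chartSymmDeriv_self, extChartAt_to_inv]
  rfl

/-- Smoothness of the coordinate field is what permits reading the manifold derivative in
`covDerivAlong` as an `fderiv`. -/
theorem localDerivRigged_self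
    (hx : ContMDiff 𝓘(ℝ, E) 𝓘(ℝ, F) ∞ x) (V : ∀ q : M, TangentSpace 𝓘(ℝ, E) q)
    (hV : ContDiffAt ℝ ∞ (fieldInChart V p) (extChartAt 𝓘(ℝ, E) p p)) :
    localDerivRigged (bilinInChart g (x p)) (mapInChart x p) (fieldInChart V p)
      (extChartAt 𝓘(ℝ, E) p p) =
      (covDerivAlong g x (fun q => dMap x q (V q)) p : E →L[ℝ] F) := by
  have hp := self_mem_mapChartDomain (E := E) (F := F) x p
  have hev : (fun y => fderiv ℝ (mapInChart (F := F) x p) y (fieldInChart V p y)) =ᶠ[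
      𝓝 (extChartAt 𝓘(ℝ, E) p p)] fun y => chartDeriv (E := F) (x p)
        (x ((extChartAt 𝓘(ℝ, E) p).symm y)) (modelDeriv x ((extChartAt 𝓘(ℝ, E) p).symm y)
          (modelField V ((extChartAt 𝓘(ℝ, E) p).symm y))) := by
    filter_upwards [mapChartDomain_mem_nhds hx.continuous hp] with y hy
    exact fderiv_mapInChart_fieldInChart hx hy V
  have hd : DifferentiableAt ℝ (fun y => chartDeriv (E := F) (x p)
        (x ((extChartAt 𝓘(ℝ, E) p).symm y)) (modelDeriv x ((extChartAt 𝓘(ℝ, E) p).symm y)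
          (modelField V ((extChartAt 𝓘(ℝ, E) p).symm y)))) (extChartAt 𝓘(ℝ, E) p p) := by
    refine DifferentiableAt.congr_of_eventuallyEq ?_ hev.symm
    exact ((((contDiffAt_mapInChart hx hp).fderiv_right (m := ∞) (by norm_cast)).clm_apply
      hV).differentiableAt (by simp))
  ext v
  have h1 := mvfderiv_apply_of_coordinates (f := fun a : M => chartDeriv (E := F) (x p) (x a)
    (modelDeriv x a (modelField V a))) hd v
  rw [IsLocalNullRigging.localDerivRigged_apply, hev.fderiv_eq, ← h1, fderiv_mapInChart_self hx, fieldInChart_self,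
    mapInChart_self]
  rfl

theorem localScreenShape_self (hg : IsSemiRiemannianMetric g)
    (hx : ContMDiff 𝓘(ℝ, E) 𝓘(ℝ, F) ∞ x) (hN : IsNullRigging (E := E) g x N U) (p : M)
    (hξ : ContDiffAt ℝ ∞ (fieldInChart (riggedField (E := E) g x N) p)
      (extChartAt 𝓘(ℝ, E) p p)) :
    localScreenShape (bilinInChart g (x p)) (mapInChart x p) (fieldInChart N (x p))
      (fieldInChart (riggedField (E := E) g x N) p) (extChartAt 𝓘(ℝ, E) p p) =
      (screenShape (E := E) g x N p : E →L[ℝ] E) := by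
  rw [localScreenShape, localProj_self hx, localDerivRigged_self hx _ hξ,
    modelForm_rotationForm hg hx hN, fieldInChart_self]
  rfl

theorem christoffel_congr {G G' : E → E →L[ℝ] E →L[ℝ] ℝ} (h : G =ᶠ[𝓝 u] G') :
    christoffel G =ᶠ[𝓝 u] christoffel G' := by
  filter_upwards [h.eventuallyEq_nhds] with y hy
  rw [christoffel, christoffel, christoffelFirst, christoffelFirst, hy.fderiv_eq, hy.eq_of_nhds]

theorem ricciOf_congr {Γ Γ' : E → E →L[ℝ] E →L[ℝ] E} (h : Γ =ᶠ[𝓝 u] Γ') (v w : E) :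
    ricciOf Γ u v w = ricciOf Γ' u v w := by
  simp only [ricciOf, curvatureOf, h.fderiv_eq, h.eq_of_nhds]

/-- The Ricci tensor of the associated metric in the direction of the rigged field. -/
theorem ricci_associatedMetric (hg : IsSemiRiemannianMetric g)
    (hx : IsNullHypersurface (E := E) g x) (hN : IsNullRigging (E := E) g x N U)
    (hclosed : ∀ (p : M) (v w : TangentSpace 𝓘(ℝ, E) p), dForm (eta g x N) p v w = 0)
    {α : M → ℝ} (hα : ContMDiff 𝓘(ℝ, E) 𝓘(ℝ, ℝ) ∞ α) (hα0 : ∀ p, α p ≠ 0)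
    (hαη : ∀ (q : M) (v : TangentSpace 𝓘(ℝ, E) q), eta g x N q v = 0 →
      mfderiv 𝓘(ℝ, E) 𝓘(ℝ, ℝ) α q v = (0 : ℝ)) (p : M) (z : TangentSpace 𝓘(ℝ, E) p) :
    ricci (associatedMetric (E := E) g x N α) p (riggedField (E := E) g x N p) z =
      ricci g (x p) (dMap (E := E) x p (riggedField (E := E) g x N p)) (dMap (E := E) x p z)
      + dForm (rotationForm (E := E) g x N) p (riggedField (E := E) g x N p) z
      - LinearMap.trace ℝ (TangentSpace 𝓘(ℝ, E) p) (screenShape (E := E) g x N p).toLinearMap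
        * (-pullbackMetric (E := E) g x p
              (shapeN (E := E) g x N p (riggedField (E := E) g x N p)) z
          + (rotationForm (E := E) g x N p (riggedField (E := E) g x N p)
            + mvfderiv 𝓘(ℝ, E) α p (riggedField (E := E) g x N p) / (2 * α p))
            * eta (E := E) g x N p z) := by
  revert z
  change ∀ z : E, _
  intro z
  have hx' : ContMDiff 𝓘(ℝ, E) 𝓘(ℝ, F) ∞ x := hx.embedding.contMDiff
  have hp := self_mem_mapChartDomain (E := E) (F := F) x p
  have hdom := mapChartDomain_mem_nhds hx'.continuous hp
  have hL : ∀ᶠ y in 𝓝 (extChartAt 𝓘(ℝ, E) p p), IsLocalNullRigging (bilinInChart g (x p))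
      (mapInChart x p) (fieldInChart N (x p)) (fieldInChart (riggedField (E := E) g x N) p) y := by
    filter_upwards [hdom] with y hy using isLocalNullRigging_inChart hg hx hN hclosed hy
  have hαd : ∀ y ∈ mapChartDomain E (F := F) x p,
      ContDiffAt ℝ ∞ (fun y => α ((extChartAt 𝓘(ℝ, E) p).symm y)) y := fun y hy =>
    ((hα _).comp y (contMDiffAt_extChartAt_symm hy.1)).contDiffAt
  have hα' : ∀ y ∈ mapChartDomain E (F := F) x p, ∀ v : E,
      fderiv ℝ (fun y => α ((extChartAt 𝓘(ℝ, E) p).symm y)) y v =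
        modelDeriv (E := E) (F := ℝ) α ((extChartAt 𝓘(ℝ, E) p).symm y)
          (chartSymmDeriv (E := E) p y v) := by
    intro y hy v
    have h := ((hα _).mdifferentiableAt (by simp)).hasMFDerivAt.comp y
      (mdifferentiableAt_extChartAt_symm hy.1).hasMFDerivAt
    have h' : HasFDerivAt (fun y => α ((extChartAt 𝓘(ℝ, E) p).symm y))
        ((modelDeriv (E := E) (F := ℝ) α ((extChartAt 𝓘(ℝ, E) p).symm y)).comp
          (chartSymmDeriv (E := E) p y)) y := hasMFDerivAt_iff_hasFDerivAt.1 h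
    rw [h'.fderiv]
    rfl
  have key := IsLocalNullRigging.ricciOf_localAssociated hL
    (α := fun y => α ((extChartAt 𝓘(ℝ, E) p).symm y))
    (by filter_upwards [hdom] with y hy using hαd y hy) (hα0 _)
    (by
      filter_upwards [hdom] with y hy v hv
      rw [hα' y hy]
      rw [localEta_eq_formInChart hx' hy] at hv
      exact hαη _ _ hv) z
  have hrot : localRotation (bilinInChart g (x p)) (mapInChart x p) (fieldInChart N (x p))
      (fieldInChart (riggedField (E := E) g x N) p) =ᶠ[𝓝 (extChartAt 𝓘(ℝ, E) p p)]
      formInChart (rotationForm (E := E) g x N) p := by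
    filter_upwards [hdom] with y hy using localRotation_eq_formInChart hg hx' hN hy
  have hass : localAssociated (bilinInChart g (x p)) (mapInChart x p) (fieldInChart N (x p))
      (fun y => α ((extChartAt 𝓘(ℝ, E) p).symm y)) =ᶠ[𝓝 (extChartAt 𝓘(ℝ, E) p p)]
      bilinInChart (associatedMetric (E := E) g x N α) p := by
    filter_upwards [hdom] with y hy using localAssociated_eq_bilinInChart hx' α hy
  have hξ := IsLocalNullRigging.contDiffAt_rigged hL
  -- The associated metric and τ get differentiated and are replaced as germs; the other objects are
  -- evaluated at the centre, where the chart derivatives are the identity.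
  rw [ricciOf_congr (christoffel_congr hass), hrot.fderiv_eq, modelForm_rotationForm hg hx' hN,
    localScreenShape_self hg hx' hN p hξ, localShape_self hg hx' hN, localEta_self hx',
    fderiv_mapInChart_self hx', mapInChart_self, bilinInChart_self, fieldInChart_self,
    extChartAt_to_inv, ← mvfderiv_apply_of_coordinates ((hαd _ hp).differentiableAt (by simp))]
    at key
  exact key

end CentredCharts

/-! ### From constancy on leaves to vanishing of dα on the screen distribution. -/

section Leaves

set_option maxSynthPendingDepth 3
set_option linter.unusedSectionVars false

variable {E : Type*} [NormedAddCommGroup E] [NormedSpace ℝ E] [FiniteDimensional ℝ E]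

/-- Near a regular point, every vector tangent to a level set of `f` is the velocity of a smooth
curve in that level set. -/
theorem exists_curve_in_level {f : E → ℝ} {u₀ : E} {s : Set E} (hs : s ∈ 𝓝 u₀)
    (hf : ∀ᶠ y in 𝓝 u₀, ContDiffAt ℝ ∞ f y) {v w : E} (hv : fderiv ℝ f u₀ v = 0)
    (hw : fderiv ℝ f u₀ w = 1) :
    ∃ σ : ℝ → E, σ 0 = u₀ ∧ HasDerivAt σ v 0 ∧
      ∀ᶠ r in 𝓝 (0 : ℝ), ContDiffAt ℝ ∞ σ r ∧ σ r ∈ s ∧ f (σ r) = f u₀ := by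
  -- Φ straightens f: its derivative at u₀ is the identity, and df(u₀)(Φ(u)) = f(u) − f(u₀) because
  -- df(u₀)(w) = 1. The inverse of Φ therefore maps lines in ker df(u₀) into the level set.
  set Φ : E → E := fun u => (u - u₀) - fderiv ℝ f u₀ (u - u₀) • w + (f u - f u₀) • w with hΦ_def
  have hΦ : ∀ᶠ y in 𝓝 u₀, ContDiffAt ℝ ∞ Φ y := by
    filter_upwards [hf] with y hy
    have h1 : ContDiffAt ℝ ∞ (fun u : E => u - u₀) y := contDiffAt_id.sub contDiffAt_const
    exact (h1.sub (((fderiv ℝ f u₀).contDiff.contDiffAt.comp y h1).smul contDiffAt_const)).add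
      ((hy.sub contDiffAt_const).smul contDiffAt_const)
  have hΦ0 : Φ u₀ = 0 := by simp [hΦ_def]
  have hd : HasFDerivAt Φ ((ContinuousLinearEquiv.refl ℝ E : E ≃L[ℝ] E) : E →L[ℝ] E) u₀ := by
    have h1 : HasFDerivAt (fun u : E => u - u₀) (ContinuousLinearMap.id ℝ E) u₀ :=
      (hasFDerivAt_id u₀).sub_const u₀
    have h2 := (hf.self_of_nhds.differentiableAt (by simp)).hasFDerivAt
    have h3 := (h1.sub (((fderiv ℝ f u₀).hasFDerivAt.comp u₀ h1).smul_const w)).add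
      ((h2.sub_const (f u₀)).smul_const w)
    refine h3.congr_fderiv ?_
    ext z
    simp
  set Ψ := hΦ.self_of_nhds.toOpenPartialHomeomorph Φ hd (by simp) with hΨ_def
  have hcoe : ∀ y, Ψ y = Φ y := fun _ => rfl
  have hsrc : u₀ ∈ Ψ.source := ContDiffAt.mem_toOpenPartialHomeomorph_source _ hd _
  have ht : (0 : E) ∈ Ψ.target := by rw [← hΦ0]; exact Ψ.map_source hsrc
  have hsymm0 : Ψ.symm 0 = u₀ := by rw [← hΦ0]; exact Ψ.left_inv hsrc
  have hcont : ContinuousAt Ψ.symm 0 := Ψ.continuousAt_symm ht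
  have htend : Tendsto Ψ.symm (𝓝 0) (𝓝 u₀) := by
    have := hcont.tendsto; rwa [hsymm0] at this
  -- The curve must be smooth for all small parameters, so the inverse function theorem is needed at
  -- nearby points too.
  have hinv : ∀ᶠ y in 𝓝 u₀, (fderiv ℝ Φ y).IsInvertible := by
    have h1 : ContinuousAt (fderiv ℝ Φ) u₀ :=
      (hΦ.self_of_nhds.fderiv_right (m := ∞) (by norm_cast)).continuousAt
    refine h1.eventually_mem (ContinuousLinearEquiv.isOpen.mem_nhds ?_)
    exact ⟨ContinuousLinearEquiv.refl ℝ E, hd.fderiv.symm⟩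
  have hsm : ∀ᶠ y in 𝓝 (0 : E), ContDiffAt ℝ ∞ Ψ.symm y ∧ Ψ.symm y ∈ s ∧
      f (Ψ.symm y) = f u₀ + fderiv ℝ f u₀ y := by
    filter_upwards [Ψ.open_target.mem_nhds ht, htend.eventually hinv, htend.eventually hΦ,
      htend.eventually hs] with y hy ⟨A, hA⟩ hy2 hys
    refine ⟨Ψ.contDiffAt_symm (f₀' := A) hy ?_ hy2, hys, ?_⟩
    · rw [hA]; exact (hy2.differentiableAt (by simp)).hasFDerivAt
    · have h := congrArg (fderiv ℝ f u₀) ((hcoe _).symm.trans (Ψ.right_inv hy))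
      simp only [hΦ_def, map_add, map_sub, map_smul, hw, smul_eq_mul, mul_one] at h
      linarith
  have hline : Tendsto (fun r : ℝ => r • v) (𝓝 0) (𝓝 0) := by
    have : Continuous fun r : ℝ => r • v := by fun_prop
    simpa using this.tendsto 0
  refine ⟨fun r => Ψ.symm (r • v), by simpa using hsymm0, ?_, ?_⟩
  · have h1 : HasFDerivAt Ψ.symm ((ContinuousLinearEquiv.refl ℝ E).symm : E →L[ℝ] E) ((0 : ℝ) • v) := by
      rw [zero_smul]
      exact Ψ.hasFDerivAt_symm ht (by rw [hsymm0]; exact hd)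
    have h2 : HasDerivAt (fun r : ℝ => r • v) v 0 := by
      simpa using (hasDerivAt_id (0 : ℝ)).smul_const v
    exact h1.comp_hasDerivAt 0 h2
  · filter_upwards [hline.eventually hsm] with r ⟨h1, h2, h3⟩
    refine ⟨h1.comp r (by fun_prop), h2, ?_⟩
    rw [h3, map_smul, hv, smul_zero, add_zero]

variable {F : Type*} [NormedAddCommGroup F] [NormedSpace ℝ F] [FiniteDimensional ℝ F]
  {M : Type*} [TopologicalSpace M] [ChartedSpace E M] [IsManifold 𝓘(ℝ, E) ∞ M]
  {M' : Type*} [TopologicalSpace M'] [ChartedSpace F M'] [IsManifold 𝓘(ℝ, F) ∞ M']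
  {g : ∀ y : M', TangentSpace 𝓘(ℝ, F) y →L[ℝ] TangentSpace 𝓘(ℝ, F) y →L[ℝ] ℝ}
  {x : M → M'} {N : ∀ y : M', TangentSpace 𝓘(ℝ, F) y} {U : Set M'}

/-- If a curve in the chart at `q` is tangent to the kernel of a form, so is its image in `M`. -/
theorem mfderiv_symm_comp_curve {θ : ∀ q : M, TangentSpace 𝓘(ℝ, E) q →L[ℝ] ℝ} {q : M}
    {ρ : ℝ → E} {t : ℝ} {ρ' : E} (hρ : HasDerivAt ρ ρ' t)
    (ht : ρ t ∈ (extChartAt 𝓘(ℝ, E) q).target) (h : formInChart θ q (ρ t) ρ' = 0) :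
    θ ((extChartAt 𝓘(ℝ, E) q).symm (ρ t))
      (mfderiv 𝓘(ℝ, ℝ) 𝓘(ℝ, E) (fun t => (extChartAt 𝓘(ℝ, E) q).symm (ρ t)) t (1 : ℝ)) = 0 := by
  have h1 := (mdifferentiableAt_extChartAt_symm ht).hasMFDerivAt.comp t
    hρ.hasFDerivAt.hasMFDerivAt
  have h2 : (modelDeriv (E := ℝ) (F := E) (fun t => (extChartAt 𝓘(ℝ, E) q).symm (ρ t)) t (1 : ℝ)) =
      chartSymmDeriv (E := E) q (ρ t) ρ' := by
    have h3 := congrArg (fun A : ℝ →L[ℝ] E => A 1) h1.mfderiv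
    refine h3.trans ?_
    change chartSymmDeriv (E := E) q (ρ t) (ContinuousLinearMap.toSpanSingleton ℝ ρ' 1) = _
    simp
  have h4 : modelForm θ ((extChartAt 𝓘(ℝ, E) q).symm (ρ t))
      (modelDeriv (E := ℝ) (F := E) (fun t => (extChartAt 𝓘(ℝ, E) q).symm (ρ t)) t (1 : ℝ)) = 0 := by
    rw [h2]; exact h
  exact h4

/-- A function constant on the leaves has differential vanishing on the screen distribution. -/
theorem mfderiv_eq_zero_of_constant_on_leaves (hg : IsSemiRiemannianMetric g)
    (hx : IsNullHypersurface (E := E) g x) (hN : IsNullRigging (E := E) g x N U)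
    (hclosed : ∀ (p : M) (v w : TangentSpace 𝓘(ℝ, E) p), dForm (eta g x N) p v w = 0)
    {α : M → ℝ} (hα : ContMDiff 𝓘(ℝ, E) 𝓘(ℝ, ℝ) ∞ α)
    (hαleaf : ∀ p, ∀ q ∈ leaf (eta (E := E) g x N) p, α q = α p)
    (q : M) (v : TangentSpace 𝓘(ℝ, E) q) (hv : eta g x N q v = 0) :
    mfderiv 𝓘(ℝ, E) 𝓘(ℝ, ℝ) α q v = (0 : ℝ) := by
  revert v
  change ∀ v : E, modelForm (eta (E := E) g x N) q v = 0 → modelDeriv (E := E) (F := ℝ) α q v = 0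
  intro v hv
  have hx' : ContMDiff 𝓘(ℝ, E) 𝓘(ℝ, F) ∞ x := hx.embedding.contMDiff
  have hq := self_mem_mapChartDomain (E := E) (F := F) x q
  have hdom := mapChartDomain_mem_nhds hx'.continuous hq
  set u₀ := extChartAt 𝓘(ℝ, E) q q with hu₀_def
  set θ := localEta (bilinInChart g (x q)) (mapInChart (E := E) x q) (fieldInChart N (x q)) with hθ_def
  have hL : ∀ y ∈ mapChartDomain E (F := F) x q, IsLocalNullRigging (bilinInChart g (x q))
      (mapInChart x q) (fieldInChart N (x q)) (fieldInChart (riggedField (E := E) g x N) q) y :=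
    fun y hy => isLocalNullRigging_inChart hg hx hN hclosed hy
  obtain ⟨ε, hε, hball⟩ := Metric.mem_nhds_iff.1 hdom
  have hθ : ∀ y ∈ Metric.ball u₀ ε, ContDiffAt ℝ ∞ θ y := fun y hy =>
    (hL y (hball hy)).contDiffAt_localEta
  -- Poincaré lemma on a ball: the closed form η has a local primitive f.
  obtain ⟨f, hf⟩ := (convex_ball u₀ ε).exists_forall_hasFDerivAt_of_fderiv_symmetric
    Metric.isOpen_ball (fun y hy => ((hθ y hy).differentiableAt (by simp)).differentiableWithinAt)
    (fun y hy a b => (hL y (hball hy)).closed a b)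
  have hfc : ContDiffOn ℝ ∞ f (Metric.ball u₀ ε) := by
    rw [contDiffOn_infty_iff_fderiv_of_isOpen Metric.isOpen_ball]
    refine ⟨fun y hy => (hf y hy).differentiableAt.differentiableWithinAt, ?_⟩
    exact ContDiffOn.congr (fun y hy => (hθ y hy).contDiffWithinAt) fun y hy => (hf y hy).fderiv
  have hballn : Metric.ball u₀ ε ∈ 𝓝 u₀ := Metric.ball_mem_nhds u₀ hε
  have h0 : u₀ ∈ Metric.ball u₀ ε := Metric.mem_ball_self hε
  have hfu : fderiv ℝ f u₀ = θ u₀ := (hf u₀ h0).fderiv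
  -- The transverse vector is ξ, as df(ξ) = η(ξ) = 1.
  obtain ⟨σ, hσ0, hσd, hσ⟩ := exists_curve_in_level (f := f) (v := v)
    (w := fieldInChart (riggedField (E := E) g x N) q u₀) hballn
    (by
      filter_upwards [Metric.isOpen_ball.mem_nhds h0] with y hy
      exact hfc.contDiffAt (Metric.isOpen_ball.mem_nhds hy))
    (by rw [hfu, hθ_def, localEta_self hx']; exact hv)
    (by rw [hfu]; exact (hL u₀ hq).localEta_rigged)
  obtain ⟨δ, hδ, hδσ⟩ := Metric.eventually_nhds_iff_ball.1 hσ
  -- Leaf curves must be defined and tangent on all of ℝ, while σ is controlled only on (−δ, δ). The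
  -- argument (δ/2) sin(rt) stays inside, and t = 0, 1 give `q` and the point with parameter (δ/2)
  -- sin r.
  have hconst : ∀ r : ℝ, α ((extChartAt 𝓘(ℝ, E) q).symm (σ (δ / 2 * Real.sin r))) = α q := by
    intro r
    apply hαleaf
    refine Relation.EqvGen.rel _ _ ⟨fun t => (extChartAt 𝓘(ℝ, E) q).symm
      (σ (δ / 2 * Real.sin (r * t))), ?_, fun t => ?_, ?_, ?_⟩
    all_goals
      have hmem : ∀ t : ℝ, δ / 2 * Real.sin (r * t) ∈ Metric.ball (0 : ℝ) δ := by
        intro t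
        rw [mem_ball_zero_iff, Real.norm_eq_abs, abs_mul, abs_of_pos (half_pos hδ)]
        have := Real.abs_sin_le_one (r * t)
        nlinarith
      have hρ : ContDiff ℝ ∞ fun t => σ (δ / 2 * Real.sin (r * t)) := by
        rw [contDiff_iff_contDiffAt]
        intro t
        exact (hδσ _ (hmem t)).1.comp t (by fun_prop)
    · intro t
      exact (contMDiffAt_extChartAt_symm (hball (hδσ _ (hmem t)).2.1).1).comp t
        hρ.contMDiff.contMDiffAt
    · have hd := ((hρ.differentiable (by simp)) t).hasDerivAt
      have hb := (hδσ _ (hmem t)).2.1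
      refine mfderiv_symm_comp_curve hd (hball hb).1 ?_
      rw [← localEta_eq_formInChart hx' (hball hb)]
      refine ((hf _ hb).comp_hasDerivAt t hd).unique ?_
      have : (f ∘ fun t => σ (δ / 2 * Real.sin (r * t))) = fun _ => f u₀ := by
        funext t
        exact (hδσ _ (hmem t)).2.2
      rw [this]
      exact hasDerivAt_const t _
    · simp [hσ0, hu₀_def]
    · simp
  have hαd : HasFDerivAt (fun y => α ((extChartAt 𝓘(ℝ, E) q).symm y))
      (modelDeriv (E := E) (F := ℝ) α q) u₀ := by
    have h := ((hα ((extChartAt 𝓘(ℝ, E) q).symm u₀)).mdifferentiableAt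
      (by simp)).hasMFDerivAt.comp u₀ (mdifferentiableAt_extChartAt_symm hq.1).hasMFDerivAt
    have h' : HasFDerivAt (fun y => α ((extChartAt 𝓘(ℝ, E) q).symm y))
        ((modelDeriv (E := E) (F := ℝ) α ((extChartAt 𝓘(ℝ, E) q).symm u₀)).comp
          (chartSymmDeriv (E := E) q u₀)) u₀ := hasMFDerivAt_iff_hasFDerivAt.1 h
    rwa [hu₀_def, chartSymmDeriv_self, extChartAt_to_inv, ContinuousLinearMap.comp_id] at h'
  have hsin : HasDerivAt (fun r => δ / 2 * Real.sin r) (δ / 2) 0 := by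
    simpa using (Real.hasDerivAt_sin 0).const_mul (δ / 2)
  have h1 : HasDerivAt (fun r => σ (δ / 2 * Real.sin r)) ((δ / 2) • v) 0 :=
    HasDerivAt.scomp (g₁ := σ) 0 (by simpa using hσd) hsin
  have h2 : HasDerivAt (fun r => α ((extChartAt 𝓘(ℝ, E) q).symm (σ (δ / 2 * Real.sin r))))
      (modelDeriv (E := E) (F := ℝ) α q ((δ / 2) • v)) 0 :=
    HasFDerivAt.comp_hasDerivAt (f := fun r => σ (δ / 2 * Real.sin r))
      (l := fun y => α ((extChartAt 𝓘(ℝ, E) q).symm y)) (0 : ℝ) (by simpa [hσ0] using hαd) h1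
  -- The endpoint moves with velocity (δ/2)v at r = 0 while α stays constant along it.
  have h3 : modelDeriv (E := E) (F := ℝ) α q ((δ / 2) • v) = 0 := by
    refine h2.unique ?_
    simp only [hconst]
    exact hasDerivAt_const 0 _
  rw [map_smul, smul_eq_mul] at h3
  exact (mul_eq_zero.1 h3).resolve_left (half_pos hδ).ne'

end Leaves

end NullGeom

end

/-! ### The two Ricci formulas. -/

theorem mainTheorem7
    {E : Type*} [NormedAddCommGroup E] [NormedSpace ℝ E] [FiniteDimensional ℝ E]
    {F : Type*} [NormedAddCommGroup F] [NormedSpace ℝ F] [FiniteDimensional ℝ F]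
    {M : Type*} [TopologicalSpace M] [ChartedSpace E M] [IsManifold 𝓘(ℝ, E) ∞ M]
    {M' : Type*} [TopologicalSpace M'] [ChartedSpace F M'] [IsManifold 𝓘(ℝ, F) ∞ M']
    (n : ℕ) (hn : Module.finrank ℝ E = n)
    (g : ∀ y : M', TangentSpace 𝓘(ℝ, F) y →L[ℝ] TangentSpace 𝓘(ℝ, F) y →L[ℝ] ℝ)
    (hg : NullGeom.IsSemiRiemannianMetric g)
    (x : M → M') (hx : NullGeom.IsNullHypersurface (E := E) g x)
    (N : ∀ y : M', TangentSpace 𝓘(ℝ, F) y) (U : Set M') (hN : NullGeom.IsNullRigging (E := E) g x N U)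
    (hclosed : ∀ (p : M) (v w : TangentSpace 𝓘(ℝ, E) p), NullGeom.dForm (NullGeom.eta g x N) p v w = 0)
    (α : M → ℝ) (hα : ContMDiff 𝓘(ℝ, E) 𝓘(ℝ, ℝ) ∞ α) (hα0 : ∀ p, α p ≠ 0)
    (hαleaf : ∀ p, ∀ q ∈ NullGeom.leaf (NullGeom.eta (E := E) g x N) p, α q = α p)
    (p : M) :
    NullGeom.ricci (NullGeom.associatedMetric (E := E) g x N α) p
        (NullGeom.riggedField (E := E) g x N p) (NullGeom.riggedField (E := E) g x N p)
      = NullGeom.ricci g (x p) (NullGeom.dMap (E := E) x p (NullGeom.riggedField (E := E) g x N p))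
          (NullGeom.dMap (E := E) x p (NullGeom.riggedField (E := E) g x N p))
        - n * (NullGeom.rotationForm (E := E) g x N p (NullGeom.riggedField (E := E) g x N p)
            + 1 / (2 * α p) *
              mvfderiv 𝓘(ℝ, E) α p (NullGeom.riggedField (E := E) g x N p))
          * NullGeom.meanCurvature (E := E) g x N p ∧
    ∀ X : TangentSpace 𝓘(ℝ, E) p, NullGeom.eta g x N p X = 0 →
      NullGeom.ricci (NullGeom.associatedMetric (E := E) g x N α) p (NullGeom.riggedField (E := E) g x N p) X
        = NullGeom.ricci g (x p) (NullGeom.dMap (E := E) x p (NullGeom.riggedField (E := E) g x N p))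
            (NullGeom.dMap (E := E) x p X)
          + NullGeom.dForm (NullGeom.rotationForm (E := E) g x N) p (NullGeom.riggedField (E := E) g x N p) X
          + n * NullGeom.pullbackMetric (E := E) g x p
              (NullGeom.shapeN (E := E) g x N p (NullGeom.riggedField (E := E) g x N p)) X
            * NullGeom.meanCurvature (E := E) g x N p := by
  have hαη := NullGeom.mfderiv_eq_zero_of_constant_on_leaves hg hx hN hclosed hα hαleaf
  have key := NullGeom.ricci_associatedMetric hg hx hN hclosed hα hα0 hαη p
  have hspec := NullGeom.riggedField_spec hg hx hN p
  obtain ⟨u, hu0, -⟩ := hx.null p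
  -- A nonzero null tangent vector rules out n = 0, so the factor 1/n in the mean curvature can be
  -- cleared.
  have hn0 : (n : ℝ) ≠ 0 := by
    rw [← hn]
    have : Nontrivial E := ⟨⟨u, 0, hu0⟩⟩
    exact_mod_cast Module.finrank_pos.ne'
  have hH : LinearMap.trace ℝ (TangentSpace 𝓘(ℝ, E) p)
      (NullGeom.screenShape (E := E) g x N p).toLinearMap =
      n * NullGeom.meanCurvature (E := E) g x N p := by
    rw [NullGeom.meanCurvature, hn, ← mul_assoc, mul_one_div_cancel hn0, one_mul]
  constructor
  -- For z = ξ the terms g(A_N ξ, ξ) and dτ(ξ, ξ) vanish and η(ξ) = 1.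
  · have h1 : NullGeom.pullbackMetric (E := E) g x p (NullGeom.shapeN (E := E) g x N p
        (NullGeom.riggedField (E := E) g x N p)) (NullGeom.riggedField (E := E) g x N p) = 0 :=
      (hg.symm _ _ _).trans (hspec.1 _)
    have h2 : NullGeom.eta (E := E) g x N p (NullGeom.riggedField (E := E) g x N p) = 1 :=
      (hg.symm _ _ _).trans hspec.2
    have h3 : NullGeom.dForm (NullGeom.rotationForm (E := E) g x N) p
        (NullGeom.riggedField (E := E) g x N p) (NullGeom.riggedField (E := E) g x N p) = 0 :=
      sub_self _
    rw [key, h1, h2, h3, hH]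
    ring
  · intro X hX
    rw [key, hX, hH]
    ring
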